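/- **Theorem (Almost-sure asymptotic convergence rate of the randomized submanifold subgradient method).** Let $n\ge p\ge 1$ and $\ell\ge 2$ be integers, let $\|\cdot\|$ and $\langle\cdot,\cdot\rangle$ be the Frobenius norm and inner product, and let $\mathrm{St}(n,p)=\{X\in\mathbb R^{n\times p}:X^\top X=I\}$. Let $f:\mathbb R^{n\times p}\to\mathbb R$ be such that, on some bounded convex neighborhood $\Omega$ of $\mathrm{St}(n,p)$, the function $f+\frac{\tau}{2}\|\cdot\|^2$ is convex and $f$ is $L$-Lipschitz, where $\tau\ge 0$ and $L>0$. Let $\partial f$ be the Clarke subdifferential of $f$. Let $\mathfrak C=\{C_1,\dots,C_\ell\}$ be a partition of $[p]$, i.e. the $C_i$ are pairwise disjoint with union $[p]$. For $C\subseteq[p]$ let $X_C$ be the submatrix of the columns of $X$ with index in $C$ and $I_C$ that of the identity. For an unordered pair $\{i,j\}$ of distinct indices put $C_{ij}=C_i\cup C_j$, $X_{ij}=X_{C_{ij}}$, $X_{-ij}=X_{[p]\setminus C_{ij}}$, $I_{ij}=I_{C_{ij}}$, and $$\mathcal M_{X_{-ij}}=\{Y\in\mathbb R^{n\times|C_{ij}|}:Y^\top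 Y=I,\ X_{-ij}^\top Y=0\},\qquad T_{X_{ij}}\mathcal M_{X_{-ij}}=\{\xi:\xi^\top X_{ij}+X_{ij}^\top\xi=0,\ X_{-ij}^\top\xi=0\}.$$ Write $\mathcal P_S$ for the nearest-point projection onto $S$. *Algorithm.* Given $X^0\in\mathrm{St}(n,p)$ and stepsizes $\gamma_k$, at each iteration $k=0,1,2,\dots$ choose a subgradient $G^k\in\partial f(X^k)$ (the choice may depend on the past but not on the pair drawn in iteration $k$ or on later ones), draw $\{i,j\}$ uniformly from the $\binom{\ell}{2}$ unordered pairs, independently of the past, and set $$D^k=\mathcal P_{T_{X^k_{ij}}\mathcal M_{X^k_{-ij}}}(G^kI_{ij}),\qquad X^{k+1}_{ij}=\mathcal P_{\mathcal M_{X^k_{-ij}}}\big(X^k_{ij}-\gamma_kD^k\big),\qquad X^{k+1}_{-ij}=X^k_{-ij}.$$ Let $\mathbb P$ be the law of the sequence of drawn pairs, i.e. the infinite product of the uniform distributions. *Stationarity measure.* For $X\in\mathrm{St}(n,p)$ let $$\mathcal A_X(\xi)=\tbinom{\ell}{2}^{-1}\sum_{\{i,j\}}(I-X_{-ij}X_{-ij}^\top)\,\xi_{ij}\,I_{ij}^\top,\qquad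 \|\xi\|_{\mathcal A_X^{-1}}=\sqrt{\langle\mathcal A_X^{-1}(\xi),\xi\rangle},$$ and, for $\lambda>0$, let $$P^{\mathfrak C}_{\lambda f}(X)=\operatorname*{argmin}_{Y\in\mathrm{St}(n,p)}\Big\{f(Y)+\tfrac1{2\lambda}\|Y-X\|^2_{\mathcal A_X^{-1}}\Big\},\qquad \Theta^{\mathfrak C}_{\lambda f}(X)=\tfrac1\lambda\big\|P^{\mathfrak C}_{\lambda f}(X)-X\big\|_{\mathcal A_X^{-1}}$$ (for the $\lambda$ considered below the minimizer is unique). *Claim.* Let $\Delta_{\min}>0$, let $\Delta_k\in\big(\Delta_{\min},\frac{\sqrt2\,\log 2}{L}\big)$ for all $k\ge0$, and let $\{X^k\}_k$ be generated by the algorithm with stepsizes $\gamma_k=\frac{\Delta_k}{\sqrt{k+2}\,\log(k+2)}$. Then, for every $\lambda\in\Big(0,\frac{\ell}{2(\tau+(2\ell-1)L)}\Big)$, $$\liminf_{k\to\infty}\ \sqrt[4]{k+2}\cdot\Theta^{\mathfrak C}_{\lambda f}(X^k)=0\qquad\mathbb P\text{-almost surely.}$$ -/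

import Mathlib

open Filter Topology MeasureTheory ProbabilityTheory
open scoped Matrix

noncomputable section

namespace RSSM

/-- The Frobenius inner product `⟨A, B⟩ = tr (Aᵀ B)`. -/
def frob {m κ : Type*} [Fintype m] [Fintype κ] (A B : Matrix m κ ℝ) : ℝ :=
  (Aᵀ * B).trace

/-- The Frobenius norm. -/
def frobNorm {m κ : Type*} [Fintype m] [Fintype κ] (A : Matrix m κ ℝ) : ℝ :=
  Real.sqrt (frob A A)

/-- The set-valued projection: all points of `S` nearest to `X` in the Frobenius norm. -/
def projSet {m κ : Type*} [Fintype m] [Fintype κ] (S : Set (Matrix m κ ℝ)) (X : Matrix m κ ℝ) :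
    Set (Matrix m κ ℝ) :=
  {Y | Y ∈ S ∧ ∀ Z ∈ S, frobNorm (X - Y) ≤ frobNorm (X - Z)}

/-- The Stiefel manifold `{X : Xᵀ X = I}`, with rows indexed by `m` and columns by `κ`. -/
def stiefel (m κ : Type*) [Fintype m] [DecidableEq κ] : Set (Matrix m κ ℝ) :=
  {X | Xᵀ * X = 1}

/-- `f` is `τ`-weakly convex on `U`: `f + (τ/2) ‖·‖²` is convex on `U`. -/
def WeaklyConvexOn {m κ : Type*} [Fintype m] [Fintype κ] (τ : ℝ) (U : Set (Matrix m κ ℝ))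
    (f : Matrix m κ ℝ → ℝ) : Prop :=
  ConvexOn ℝ U (fun X => f X + τ / 2 * frobNorm X ^ 2)

/-- `f` is `L`-Lipschitz on `U` for the Frobenius norm. -/
def FrobLipschitzOn {m κ : Type*} [Fintype m] [Fintype κ] (L : ℝ) (U : Set (Matrix m κ ℝ))
    (f : Matrix m κ ℝ → ℝ) : Prop :=
  ∀ X ∈ U, ∀ Y ∈ U, |f X - f Y| ≤ L * frobNorm (X - Y)

/-- Clarke's generalized directional derivative
`f°(X; V) = limsup_{Y → X, t ↓ 0} (f (Y + t V) - f Y) / t`, with values in the extended reals. -/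
def clarkeDeriv {m κ : Type*} (f : Matrix m κ ℝ → ℝ) (X V : Matrix m κ ℝ) : EReal :=
  limsup (fun q : Matrix m κ ℝ × ℝ => (((f (q.1 + q.2 • V) - f q.1) / q.2 : ℝ) : EReal))
    (𝓝 X ×ˢ 𝓝[>] (0 : ℝ))

/-- The Clarke subdifferential `∂f(X) = {G : ⟨G, V⟩ ≤ f°(X; V) for all V}`. -/
def clarkeSubdiff {m κ : Type*} [Fintype m] [Fintype κ] (f : Matrix m κ ℝ → ℝ)
    (X : Matrix m κ ℝ) : Set (Matrix m κ ℝ) :=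
  {G | ∀ V, ((frob G V : ℝ) : EReal) ≤ clarkeDeriv f X V}

/-- The submatrix `X_C` of the columns of `X` with index in `C`. -/
def cols {n p : ℕ} (X : Matrix (Fin n) (Fin p) ℝ) (C : Finset (Fin p)) : Matrix (Fin n) C ℝ :=
  X.submatrix id Subtype.val

/-- The matrix `I_C` of the columns of the identity with index in `C`; thus `X_C = X I_C`, and
`Y I_Cᵀ` is the matrix whose columns in `C` are those of `Y` and whose other columns vanish. -/
def colSel {p : ℕ} (C : Finset (Fin p)) : Matrix (Fin p) C ℝ :=
  (1 : Matrix (Fin p) (Fin p) ℝ).submatrix id Subtype.val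

/-- The submanifold block at `X` with respect to `C`: matrices with orthonormal columns (indexed
by `C`) that are orthogonal to the columns of `X` outside `C`. -/
def submfdBlock {n p : ℕ} (X : Matrix (Fin n) (Fin p) ℝ) (C : Finset (Fin p)) :
    Set (Matrix (Fin n) C ℝ) :=
  {Y | Y ∈ stiefel (Fin n) C ∧ (cols X Cᶜ)ᵀ * Y = 0}

/-- The tangent space at `X_C` to the submanifold block at `X` with respect to `C`. -/
def tangentBlock {n p : ℕ} (X : Matrix (Fin n) (Fin p) ℝ) (C : Finset (Fin p)) :
    Set (Matrix (Fin n) C ℝ) :=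
  {ξ | ξᵀ * cols X C + (cols X C)ᵀ * ξ = 0 ∧ (cols X Cᶜ)ᵀ * ξ = 0}

/-- `C 0, …, C (ℓ-1)` is a partition of the column indices. -/
def IsBlockPartition {p ℓ : ℕ} (C : Fin ℓ → Finset (Fin p)) : Prop :=
  (∀ i j, i ≠ j → Disjoint (C i) (C j)) ∧ ∀ a, ∃ i, a ∈ C i

/-- Unordered pairs `{i, j}` of distinct block indices. -/
abbrev BlockPair (ℓ : ℕ) : Type := {e : Finset (Fin ℓ) // e.card = 2}

/-- `C_{ij} = C_i ∪ C_j`. -/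
def pairCols {p ℓ : ℕ} (C : Fin ℓ → Finset (Fin p)) (e : BlockPair ℓ) : Finset (Fin p) :=
  e.1.biUnion C

/-- The averaging operator
`A_X(ξ) = (ℓ choose 2)⁻¹ ∑_{{i,j}} (I - X_{-ij} X_{-ij}ᵀ) ξ_{ij} I_{ij}ᵀ`. -/
def avgOp {n p ℓ : ℕ} (C : Fin ℓ → Finset (Fin p)) (X : Matrix (Fin n) (Fin p) ℝ) :
    Matrix (Fin n) (Fin p) ℝ →ₗ[ℝ] Matrix (Fin n) (Fin p) ℝ where
  toFun ξ := ((ℓ.choose 2 : ℝ))⁻¹ • ∑ e : BlockPair ℓ,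
    (1 - cols X (pairCols C e)ᶜ * (cols X (pairCols C e)ᶜ)ᵀ) *
      (cols ξ (pairCols C e) * (colSel (pairCols C e))ᵀ)
  map_add' ξ η := by
    rw [← smul_add, ← Finset.sum_add_distrib]
    congr 1
    refine Finset.sum_congr rfl fun e _ => ?_
    rw [← Matrix.mul_add, ← Matrix.add_mul]
    rfl
  map_smul' c ξ := by
    rw [RingHom.id_apply, smul_comm c]
    congr 1
    rw [Finset.smul_sum]
    refine Finset.sum_congr rfl fun e _ => ?_
    rw [← Matrix.mul_smul, ← Matrix.smul_mul]
    rfl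

/-- The Mahalanobis norm `‖ξ‖ = √⟨A_X⁻¹(ξ), ξ⟩` of the inverse of the averaging operator. -/
def adaptiveNorm {n p ℓ : ℕ} (C : Fin ℓ → Finset (Fin p)) (X ξ : Matrix (Fin n) (Fin p) ℝ) : ℝ :=
  Real.sqrt (frob (Ring.inverse (avgOp C X) ξ) ξ)

/-- The minimizers over the Stiefel manifold of `Y ↦ f(Y) + (2λ)⁻¹ ‖Y - X‖²` in the adaptive norm
at `X` (the parameter `λ` is called `lam`). -/
def adaptiveProxSet {n p ℓ : ℕ} (f : Matrix (Fin n) (Fin p) ℝ → ℝ) (C : Fin ℓ → Finset (Fin p))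
    (lam : ℝ) (X : Matrix (Fin n) (Fin p) ℝ) : Set (Matrix (Fin n) (Fin p) ℝ) :=
  {Y | Y ∈ stiefel (Fin n) (Fin p) ∧ ∀ Z ∈ stiefel (Fin n) (Fin p),
    f Y + 1 / (2 * lam) * adaptiveNorm C X (Y - X) ^ 2 ≤
      f Z + 1 / (2 * lam) * adaptiveNorm C X (Z - X) ^ 2}

/-- The adaptive proximal map, as a point: an element of the set of minimizers. -/
def adaptiveProx {n p ℓ : ℕ} (f : Matrix (Fin n) (Fin p) ℝ → ℝ) (C : Fin ℓ → Finset (Fin p))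
    (lam : ℝ) (X : Matrix (Fin n) (Fin p) ℝ) : Matrix (Fin n) (Fin p) ℝ :=
  Classical.epsilon fun Y => Y ∈ adaptiveProxSet f C lam X

/-- The surrogate stationarity measure `Θ(X) = λ⁻¹ ‖P(X) - X‖` in the adaptive norm at `X`, where
`P` is the adaptive proximal map. -/
def surrogateMeasure {n p ℓ : ℕ} (f : Matrix (Fin n) (Fin p) ℝ → ℝ) (C : Fin ℓ → Finset (Fin p))
    (lam : ℝ) (X : Matrix (Fin n) (Fin p) ℝ) : ℝ :=
  1 / lam * adaptiveNorm C X (adaptiveProx f C lam X - X)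

/-- `X'` is obtained from `X` by one step on the columns `C` with stepsize `γ` and Euclidean
subgradient `G`: the partial subgradient `G_C = G I_C` is projected onto the tangent space of the
submanifold block, the columns in `C` take the resulting step, which is projected back onto the
submanifold block, and the other columns do not change. -/
def IsStep {n p : ℕ} (γ : ℝ) (C : Finset (Fin p)) (X G X' : Matrix (Fin n) (Fin p) ℝ) : Prop :=
  ∃ D ∈ projSet (tangentBlock X C) (cols G C),
    cols X' C ∈ projSet (submfdBlock X C) (cols X C - γ • D) ∧ cols X' Cᶜ = cols X Cᶜ

/-- The law of the selected pairs: the product, on the space of sequences of pairs, of the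
uniform distributions. -/
def pairLaw (ℓ : ℕ) : Measure (ℕ → BlockPair ℓ) :=
  Measure.infinitePi fun _ => uniformOn (Set.univ : Set (BlockPair ℓ))

/-- `X k ω` are the iterates of the randomized submanifold subgradient method started at `X₀`,
when the sequence of selected pairs is `ω` (iteration `k` updates the pair `ω k`) and `G k ω` is
the subgradient of `f` at `X k ω` that iteration `k` uses. The subgradient may depend on the
pairs selected in earlier iterations, but not on the pair drawn in iteration `k` or later. -/
structure IsRun {n p ℓ : ℕ} (f : Matrix (Fin n) (Fin p) ℝ → ℝ) (C : Fin ℓ → Finset (Fin p))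
    (γ : ℕ → ℝ) (X₀ : Matrix (Fin n) (Fin p) ℝ)
    (G X : ℕ → (ℕ → BlockPair ℓ) → Matrix (Fin n) (Fin p) ℝ) : Prop where
  init : ∀ ω, X 0 ω = X₀
  nonanticipating : ∀ k, DependsOn (G k) (Set.Iio k)
  subgrad : ∀ k ω, G k ω ∈ clarkeSubdiff f (X k ω)
  step : ∀ k ω, IsStep (γ k) (pairCols C (ω k)) (X k ω) (G k ω) (X (k + 1) ω)

end RSSM

end

/-! The proof is a descent argument for the envelope `V(X) = min_Y f(Y) + ‖Y - X‖²_{A_X⁻¹} / (2λ)`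
over the Stiefel manifold, carried out in expectation.

Summed over all pairs, the projected partial subgradients equal `(ℓ choose 2) A_X` applied to the
Riemannian subgradient (`sum_stepDir`, `avgOp_apply`). The `A_X⁻¹` in the adaptive metric undoes
this preconditioning, so the average first-order change of the squared adaptive distance to a fixed
`Y` is governed by `⟨G, Y - X⟩`. Two errors of size `L ‖Y - X‖²` remain: the curvature of the
Stiefel manifold (`frob_riemGrad_le`) and the dependence of the metric on `X` (`sum_proxSlope_le`).
The metric is explicit because `ξ ↦ X offBlock(Xᵀ ξ)` is idempotent, so `A_X` is a combination of
the identity and one projection.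

Taking `Y` to be the proximal point of `X`, the weakly convex subgradient inequality and the
minimality of `Y` give a decrease of order `γ Θ(X)²`, with a positive factor exactly because of the
bound on `λ`. The projection onto the block manifold is a polar factor and differs from the
unprojected point by `O(γ²)`. Hence `E V(X^{k+1}) ≤ E V(X^k) - c γ_k E Θ(X^k)² + K γ_k²`
(`IsRun.integral_envelope_le`).

As `V` is bounded below and `∑ γ_k² < ∞`, telescoping gives `∑ γ_k E Θ(X^k)² < ∞`. By Tonelli `∑ γ_k
Θ(X^k)² < ∞` almost surely, without martingale convergence. If `(k+2)^{1/4} Θ(X^k)` stayed above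
some `ε > 0`, this sum would dominate a multiple of the divergent `∑ 1 / (k log k)`. -/

noncomputable section

namespace RSSM

/-! ### Frobenius geometry and compactness of the Stiefel manifold. -/

section Frobenius

variable {m κ ι : Type*} [Fintype m] [Fintype κ] [Fintype ι]

theorem frob_eq_sum (A B : Matrix m κ ℝ) : frob A B = ∑ i, ∑ a, A i a * B i a := by
  simp only [frob, Matrix.trace, Matrix.diag, Matrix.mul_apply, Matrix.transpose_apply]
  exact Finset.sum_comm

theorem frob_comm (A B : Matrix m κ ℝ) : frob A B = frob B A := by
  simp only [frob_eq_sum, mul_comm]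

theorem frob_add_left (A B D : Matrix m κ ℝ) : frob (A + B) D = frob A D + frob B D := by
  simp [frob, Matrix.add_mul]

theorem frob_add_right (A B D : Matrix m κ ℝ) : frob A (B + D) = frob A B + frob A D := by
  simp [frob, Matrix.mul_add]

theorem frob_sub_left (A B D : Matrix m κ ℝ) : frob (A - B) D = frob A D - frob B D := by
  simp [frob, Matrix.sub_mul]

theorem frob_sub_right (A B D : Matrix m κ ℝ) : frob A (B - D) = frob A B - frob A D := by
  simp [frob, Matrix.mul_sub]

theorem frob_smul_left (c : ℝ) (A B : Matrix m κ ℝ) : frob (c • A) B = c * frob A B := by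
  simp [frob]

theorem frob_smul_right (c : ℝ) (A B : Matrix m κ ℝ) : frob A (c • B) = c * frob A B := by
  simp [frob]

theorem frob_neg_left (A B : Matrix m κ ℝ) : frob (-A) B = -frob A B := by
  simp [frob]

theorem frob_neg_right (A B : Matrix m κ ℝ) : frob A (-B) = -frob A B := by
  simp [frob]

@[simp] theorem frob_zero_left (B : Matrix m κ ℝ) : frob 0 B = 0 := by simp [frob]

@[simp] theorem frob_zero_right (A : Matrix m κ ℝ) : frob A 0 = 0 := by simp [frob]

theorem frob_sum_left {α : Type*} (s : Finset α) (A : α → Matrix m κ ℝ) (B : Matrix m κ ℝ) :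
    frob (∑ e ∈ s, A e) B = ∑ e ∈ s, frob (A e) B := by
  simp [frob, Matrix.transpose_sum, Matrix.sum_mul, Matrix.trace_sum]

theorem frob_mul_left (A : Matrix m ι ℝ) (B : Matrix ι κ ℝ) (D : Matrix m κ ℝ) :
    frob (A * B) D = frob B (Aᵀ * D) := by
  simp [frob, Matrix.transpose_mul, Matrix.mul_assoc]

theorem frob_mul_right (A : Matrix m ι ℝ) (B : Matrix ι κ ℝ) (D : Matrix m κ ℝ) :
    frob (A * B) D = frob A (D * Bᵀ) := by
  rw [frob, frob, Matrix.transpose_mul, Matrix.mul_assoc, Matrix.trace_mul_comm, Matrix.mul_assoc]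

theorem frob_transpose (A B : Matrix m κ ℝ) : frob Aᵀ Bᵀ = frob A B := by
  simp only [frob_eq_sum, Matrix.transpose_apply]
  exact Finset.sum_comm

theorem frob_self_nonneg (A : Matrix m κ ℝ) : 0 ≤ frob A A := by
  rw [frob_eq_sum]
  exact Finset.sum_nonneg fun i _ => Finset.sum_nonneg fun a _ => mul_self_nonneg _

theorem frob_self_eq_zero {A : Matrix m κ ℝ} (h : frob A A ≤ 0) : A = 0 := by
  have h0 : ∑ i, ∑ a, A i a * A i a = 0 := by
    rw [← frob_eq_sum]; exact le_antisymm h (frob_self_nonneg A)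
  ext i a
  have h1 := (Finset.sum_eq_zero_iff_of_nonneg
    (fun i _ => Finset.sum_nonneg fun a _ => mul_self_nonneg (A i a))).1 h0 i (Finset.mem_univ _)
  have h2 := (Finset.sum_eq_zero_iff_of_nonneg
    (fun a _ => mul_self_nonneg (A i a))).1 h1 a (Finset.mem_univ _)
  simpa using h2

theorem frobNorm_sq (A : Matrix m κ ℝ) : frobNorm A ^ 2 = frob A A :=
  Real.sq_sqrt (frob_self_nonneg A)

theorem frobNorm_nonneg (A : Matrix m κ ℝ) : 0 ≤ frobNorm A := Real.sqrt_nonneg _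

@[simp] theorem frobNorm_zero : frobNorm (0 : Matrix m κ ℝ) = 0 := by simp [frobNorm]

theorem frobNorm_neg (A : Matrix m κ ℝ) : frobNorm (-A) = frobNorm A := by
  simp [frobNorm, frob_neg_left, frob_neg_right]

theorem frobNorm_sub_comm (A B : Matrix m κ ℝ) : frobNorm (A - B) = frobNorm (B - A) := by
  rw [← frobNorm_neg, neg_sub]

theorem frobNorm_transpose (A : Matrix m κ ℝ) : frobNorm Aᵀ = frobNorm A := by
  rw [frobNorm, frob_transpose, frobNorm]

theorem frobNorm_smul (c : ℝ) (A : Matrix m κ ℝ) : frobNorm (c • A) = |c| * frobNorm A := by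
  rw [frobNorm, frob_smul_left, frob_smul_right, ← mul_assoc, Real.sqrt_mul (mul_self_nonneg c),
    Real.sqrt_mul_self_eq_abs, frobNorm]

theorem frob_sq_le (A B : Matrix m κ ℝ) : frob A B ^ 2 ≤ frob A A * frob B B := by
  simp only [frob_eq_sum, ← Finset.sum_product' (f := fun i a => A i a * B i a),
    ← Finset.sum_product' (f := fun i a => A i a * A i a),
    ← Finset.sum_product' (f := fun i a => B i a * B i a)]
  have := Finset.sum_mul_sq_le_sq_mul_sq (Finset.univ ×ˢ Finset.univ)
    (fun x : m × κ => A x.1 x.2) (fun x : m × κ => B x.1 x.2)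
  simpa [sq] using this

theorem abs_frob_le (A B : Matrix m κ ℝ) : |frob A B| ≤ frobNorm A * frobNorm B := by
  refine abs_le_of_sq_le_sq ?_ (mul_nonneg (frobNorm_nonneg _) (frobNorm_nonneg _))
  rw [mul_pow, frobNorm_sq, frobNorm_sq]
  exact frob_sq_le A B

theorem frob_le (A B : Matrix m κ ℝ) : frob A B ≤ frobNorm A * frobNorm B :=
  (le_abs_self _).trans (abs_frob_le A B)

theorem frobNorm_add_le (A B : Matrix m κ ℝ) : frobNorm (A + B) ≤ frobNorm A + frobNorm B := by
  refine le_of_sq_le_sq ?_ (add_nonneg (frobNorm_nonneg _) (frobNorm_nonneg _))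
  have := frob_le A B
  rw [frobNorm_sq, frob_add_left, frob_add_right, frob_add_right, frob_comm B A]
  nlinarith [frobNorm_sq A, frobNorm_sq B]

theorem frobNorm_sub_le (A B : Matrix m κ ℝ) : frobNorm (A - B) ≤ frobNorm A + frobNorm B := by
  simpa [sub_eq_add_neg, frobNorm_neg] using frobNorm_add_le A (-B)

theorem frobNorm_mul_le (A : Matrix m ι ℝ) (B : Matrix ι κ ℝ) :
    frobNorm (A * B) ≤ frobNorm A * frobNorm B := by
  refine le_of_sq_le_sq ?_ (mul_nonneg (frobNorm_nonneg _) (frobNorm_nonneg _))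
  have hB : frob B B = ∑ a, ∑ j, B j a * B j a := by
    rw [frob_eq_sum]; exact Finset.sum_comm
  rw [mul_pow, frobNorm_sq, frobNorm_sq, frobNorm_sq, frob_eq_sum, frob_eq_sum A, hB,
    Finset.sum_mul_sum]
  refine Finset.sum_le_sum fun i _ => Finset.sum_le_sum fun a _ => ?_
  rw [Matrix.mul_apply]
  simpa [sq] using Finset.sum_mul_sq_le_sq_mul_sq Finset.univ (fun j => A i j) (fun j => B j a)

theorem abs_apply_le_frobNorm (A : Matrix m κ ℝ) (i : m) (a : κ) : |A i a| ≤ frobNorm A := by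
  refine Real.abs_le_sqrt ?_
  rw [frob_eq_sum, sq]
  exact (Finset.single_le_sum (f := fun a => A i a * A i a)
    (fun a _ => mul_self_nonneg _) (Finset.mem_univ a)).trans
    (Finset.single_le_sum (f := fun i => ∑ a, A i a * A i a)
      (fun i _ => Finset.sum_nonneg fun a _ => mul_self_nonneg _) (Finset.mem_univ i))

theorem continuous_frob : Continuous fun q : Matrix m κ ℝ × Matrix m κ ℝ => frob q.1 q.2 := by
  unfold frob
  fun_prop

theorem continuous_frobNorm : Continuous (frobNorm : Matrix m κ ℝ → ℝ) :=
  Real.continuous_sqrt.comp (continuous_frob.comp (continuous_id.prodMk continuous_id))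

section Isometry

variable [DecidableEq κ]

theorem frob_isometry {Q : Matrix m κ ℝ} (hQ : Qᵀ * Q = 1) (A B : Matrix κ ι ℝ) :
    frob (Q * A) (Q * B) = frob A B := by
  rw [frob_mul_left, ← Matrix.mul_assoc, hQ, Matrix.one_mul]

theorem frobNorm_isometry {Q : Matrix m κ ℝ} (hQ : Qᵀ * Q = 1) (A : Matrix κ ι ℝ) :
    frobNorm (Q * A) = frobNorm A := by
  rw [frobNorm, frob_isometry hQ, frobNorm]

/-- `‖Qᵀ A‖² = ⟨Q Qᵀ A, A⟩`; Cauchy–Schwarz applies, and `Q` is an isometry. -/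
theorem frobNorm_transpose_mul_le {Q : Matrix m κ ℝ} (hQ : Qᵀ * Q = 1) (A : Matrix m ι ℝ) :
    frobNorm (Qᵀ * A) ≤ frobNorm A := by
  have h1 : frobNorm (Qᵀ * A) ^ 2 = frob (Q * (Qᵀ * A)) A := by
    rw [frobNorm_sq, frob_mul_left, Matrix.transpose_transpose, frob_comm]
  have h2 := frob_le (Q * (Qᵀ * A)) A
  rw [frobNorm_isometry hQ] at h2
  by_contra! h
  nlinarith [frobNorm_nonneg A]

theorem frobNorm_stiefel {Q : Matrix m κ ℝ} (hQ : Q ∈ stiefel m κ) :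
    frobNorm Q ^ 2 = Fintype.card κ := by
  have h : Qᵀ * Q = 1 := hQ
  rw [frobNorm_sq, frob, h, Matrix.trace_one]

theorem isCompact_stiefel : IsCompact (stiefel m κ) := by
  have hcl : IsClosed (stiefel m κ) :=
    isClosed_eq (f := fun X : Matrix m κ ℝ => Xᵀ * X) (by fun_prop) continuous_const
  have hK : IsCompact (Set.univ.pi fun _ : m => Set.univ.pi fun _ : κ =>
      Set.Icc (-Real.sqrt (Fintype.card κ)) (Real.sqrt (Fintype.card κ))) :=
    isCompact_univ_pi fun _ => isCompact_univ_pi fun _ => isCompact_Icc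
  refine IsCompact.of_isClosed_subset hK hcl ?_
  intro X hX
  refine Set.mem_univ_pi.2 fun i => Set.mem_univ_pi.2 fun a => ?_
  rw [Set.mem_Icc, ← abs_le]
  refine (abs_apply_le_frobNorm X i a).trans ?_
  rw [← frobNorm_stiefel hX, Real.sqrt_sq (frobNorm_nonneg _)]

end Isometry

end Frobenius

/-! ### Clarke subgradients of weakly convex Lipschitz functions. -/

section Clarke

theorem clarkeDeriv_le {m κ : Type*} {f : Matrix m κ ℝ → ℝ}
    {X V : Matrix m κ ℝ} {c : ℝ}
    (h : ∀ ε > 0, ∀ᶠ q : Matrix m κ ℝ × ℝ in 𝓝 X ×ˢ 𝓝[>] (0 : ℝ),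
      (f (q.1 + q.2 • V) - f q.1) / q.2 ≤ c + ε) :
    clarkeDeriv f X V ≤ c := by
  refine EReal.le_of_forall_lt_iff_le.1 fun z hz => ?_
  have hz' : c < z := by exact_mod_cast hz
  refine limsup_le_of_le (by isBoundedDefault) ?_
  filter_upwards [h (z - c) (sub_pos.2 hz')] with q hq
  exact_mod_cast (by linarith : (f (q.1 + q.2 • V) - f q.1) / q.2 ≤ z)

theorem tendsto_add_smul {m κ : Type*} (X V : Matrix m κ ℝ) :
    Tendsto (fun q : Matrix m κ ℝ × ℝ => q.1 + q.2 • V) (𝓝 X ×ˢ 𝓝[>] (0 : ℝ)) (𝓝 X) := by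
  have h : Tendsto (fun q : Matrix m κ ℝ × ℝ => q.1 + q.2 • V) (𝓝 X ×ˢ 𝓝 (0 : ℝ))
      (𝓝 (X + (0 : ℝ) • V)) := by
    rw [← nhds_prod_eq]
    exact Continuous.tendsto (f := fun q : Matrix m κ ℝ × ℝ => q.1 + q.2 • V) (by fun_prop) (X, 0)
  rw [zero_smul, add_zero] at h
  exact h.mono_left (prod_mono le_rfl nhdsWithin_le_nhds)

theorem eventually_pos_prod {m κ : Type*} (X : Matrix m κ ℝ) :
    ∀ᶠ q : Matrix m κ ℝ × ℝ in 𝓝 X ×ˢ 𝓝[>] (0 : ℝ), 0 < q.2 :=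
  tendsto_snd.eventually eventually_mem_nhdsWithin
variable {m κ : Type*} [Fintype m] [Fintype κ] {f : Matrix m κ ℝ → ℝ}
  {U : Set (Matrix m κ ℝ)} {τ L : ℝ} {X Y G : Matrix m κ ℝ}

theorem continuousAt_of_frobLipschitzOn (hlip : FrobLipschitzOn L U f) (hX : U ∈ 𝓝 X) :
    ContinuousAt f X := by
  have h0 : Tendsto (fun Z => L * frobNorm (Z - X)) (𝓝 X) (𝓝 0) := by
    have h := (Continuous.tendsto (f := fun Z => L * frobNorm (Z - X))
      (continuous_const.mul (continuous_frobNorm.comp (continuous_id.sub continuous_const))) X)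
    simpa using h
  rw [ContinuousAt, tendsto_iff_dist_tendsto_zero]
  refine squeeze_zero' (Eventually.of_forall fun _ => dist_nonneg) ?_ h0
  filter_upwards [hX] with Z hZ
  exact hlip Z hZ X (mem_of_mem_nhds hX)

/-- Testing the subgradient in its own direction gives `‖G‖² ≤ f°(X; G) ≤ L ‖G‖`. -/
theorem frobNorm_le_of_mem_clarkeSubdiff (hL : 0 ≤ L) (hlip : FrobLipschitzOn L U f)
    (hX : U ∈ 𝓝 X) (hG : G ∈ clarkeSubdiff f X) : frobNorm G ≤ L := by
  have h : clarkeDeriv f X G ≤ ((L * frobNorm G : ℝ) : EReal) := by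
    refine clarkeDeriv_le fun ε hε => ?_
    filter_upwards [eventually_pos_prod X, (tendsto_add_smul X G).eventually hX,
      tendsto_fst.eventually hX] with q hq h1 h2
    rw [div_le_iff₀ hq]
    have h3 := (le_abs_self _).trans (hlip _ h1 _ h2)
    rw [add_sub_cancel_left, frobNorm_smul, abs_of_pos hq] at h3
    nlinarith
  have h2 : frob G G ≤ L * frobNorm G := by exact_mod_cast (hG G).trans h
  rw [← frobNorm_sq] at h2
  by_contra! h3
  nlinarith

/-- For convex `g`, difference quotients increase along a segment, so those of `f` at a moving base
point `Z` in direction `V` are bounded using `g (Z + V) - g Z`. This bound is continuous in `Z`,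
which handles the limsup over base points in Clarke's derivative. -/
theorem frob_sub_le_of_mem_clarkeSubdiff (hf : WeaklyConvexOn τ U f)
    (hlip : FrobLipschitzOn L U f) (hX : U ∈ 𝓝 X) (hY : U ∈ 𝓝 Y)
    (hG : G ∈ clarkeSubdiff f X) :
    frob G (Y - X) ≤ f Y - f X + τ / 2 * frobNorm (Y - X) ^ 2 := by
  set V := Y - X with hV
  set g : Matrix m κ ℝ → ℝ := fun Z => f Z + τ / 2 * frobNorm Z ^ 2 with hg
  have hgc : ∀ {Z}, U ∈ 𝓝 Z → ContinuousAt g Z := fun hZ =>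
    (continuousAt_of_frobLipschitzOn hlip hZ).add
      (continuous_const.mul (continuous_frobNorm.pow 2)).continuousAt
  have hshift : Tendsto (fun q : Matrix m κ ℝ × ℝ => q.1 + V) (𝓝 X ×ˢ 𝓝[>] (0 : ℝ)) (𝓝 Y) := by
    have h : Tendsto (fun Z : Matrix m κ ℝ => Z + V) (𝓝 X) (𝓝 (X + V)) :=
      (continuous_id.add continuous_const).tendsto X
    rw [hV, add_sub_cancel] at h
    exact h.comp tendsto_fst
  -- The two subtracted terms are the difference quotient of `τ/2 ‖·‖²` at `q.1` with increment `q.2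
  -- • V`.
  have hlim : Tendsto (fun q : Matrix m κ ℝ × ℝ =>
      g (q.1 + V) - g q.1 - τ * frob q.1 V - τ / 2 * q.2 * frob V V)
      (𝓝 X ×ˢ 𝓝[>] (0 : ℝ)) (𝓝 (g Y - g X - τ * frob X V - τ / 2 * 0 * frob V V)) := by
    have h1 := (hgc hY).tendsto.comp hshift
    have h2 : Tendsto (fun q : Matrix m κ ℝ × ℝ => g q.1) (𝓝 X ×ˢ 𝓝[>] (0 : ℝ)) (𝓝 (g X)) :=
      (hgc hX).tendsto.comp tendsto_fst
    have h3 : Tendsto (fun q : Matrix m κ ℝ × ℝ => frob q.1 V) (𝓝 X ×ˢ 𝓝[>] (0 : ℝ))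
        (𝓝 (frob X V)) :=
      ((continuous_frob.comp (continuous_id.prodMk continuous_const)).tendsto X).comp tendsto_fst
    have h4 : Tendsto (fun q : Matrix m κ ℝ × ℝ => q.2) (𝓝 X ×ˢ 𝓝[>] (0 : ℝ)) (𝓝 0) :=
      tendsto_snd.mono_right nhdsWithin_le_nhds
    exact ((h1.sub h2).sub (h3.const_mul τ)).sub ((h4.const_mul (τ / 2)).mul_const _)
  have hval : g Y - g X - τ * frob X V - τ / 2 * 0 * frob V V
      = f Y - f X + τ / 2 * frobNorm V ^ 2 := by
    have hYX : Y = X + V := by rw [hV, add_sub_cancel]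
    have : frobNorm Y ^ 2 = frobNorm X ^ 2 + 2 * frob X V + frobNorm V ^ 2 := by
      rw [hYX, frobNorm_sq, frobNorm_sq, frobNorm_sq, frob_add_left, frob_add_right,
        frob_add_right, frob_comm V X]
      ring
    simp only [hg, this]
    ring
  rw [hval] at hlim
  have h : clarkeDeriv f X V ≤ ((f Y - f X + τ / 2 * frobNorm V ^ 2 : ℝ) : EReal) := by
    refine clarkeDeriv_le fun ε hε => ?_
    have hlt : ∀ᶠ q : Matrix m κ ℝ × ℝ in 𝓝 X ×ˢ 𝓝[>] (0 : ℝ), q.2 < 1 :=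
      (tendsto_snd.mono_right nhdsWithin_le_nhds).eventually (gt_mem_nhds one_pos)
    filter_upwards [hlim.eventually (gt_mem_nhds (lt_add_of_pos_right _ hε)), eventually_pos_prod X,
      hlt, tendsto_fst.eventually hX, hshift.eventually hY] with q h1 hq hq1 hqU hqU'
    rw [div_le_iff₀ hq]
    have hconv := hf.2 hqU hqU' (sub_nonneg.2 hq1.le) hq.le (sub_add_cancel _ _)
    have hpt : (1 - q.2) • q.1 + q.2 • (q.1 + V) = q.1 + q.2 • V := by
      rw [smul_add, sub_smul, one_smul]; abel
    rw [hpt] at hconv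
    have hexp : frobNorm (q.1 + q.2 • V) ^ 2
        = frobNorm q.1 ^ 2 + 2 * q.2 * frob q.1 V + q.2 ^ 2 * frob V V := by
      rw [frobNorm_sq, frobNorm_sq, frob_add_left, frob_add_right, frob_add_right,
        frob_smul_left, frob_smul_right, frob_smul_left, frob_smul_right, frob_comm V q.1]
      ring
    simp only [smul_eq_mul, hexp] at hconv
    simp only [hg] at h1
    nlinarith [mul_le_mul_of_nonneg_left h1.le hq.le]
  exact_mod_cast (hG V).trans h

end Clarke

/-! ### Polar factors as nearest points. -/

section Polar

theorem trace_mul_gram_nonneg {m κ : Type*} [Fintype m] [Fintype κ]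
    {T : Matrix κ κ ℝ} (hT : T.PosSemidef) (M : Matrix m κ ℝ) :
    0 ≤ frob (M * T) M := by
  have h : (M * T * Mᵀ).PosSemidef := by
    simpa using hT.mul_mul_conjTranspose_same M
  have h2 := h.trace_nonneg
  rwa [frob_comm, frob, Matrix.trace_mul_comm]

variable {m κ : Type*} [Fintype m] [Fintype κ] [DecidableEq κ]

/-- `T` is `√(1 + A) - 1`, built from the spectral theorem. Splitting off the identity isolates the
part of the root that measures the retraction error. -/
theorem exists_posSemidef_one_add_sq {A : Matrix κ κ ℝ} (hA : A.PosSemidef) :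
    ∃ T : Matrix κ κ ℝ, T.PosSemidef ∧ (1 + T) * (1 + T) = 1 + A := by
  obtain ⟨V, d, hV, hd, hAV⟩ : ∃ (V : Matrix κ κ ℝ) (d : κ → ℝ), Vᵀ * V = 1 ∧ (∀ i, 0 ≤ d i) ∧
      A = V * Matrix.diagonal d * Vᵀ := by
    refine ⟨hA.1.eigenvectorUnitary, hA.1.eigenvalues, ?_, hA.eigenvalues_nonneg, ?_⟩
    · have := Unitary.coe_star_mul_self hA.1.eigenvectorUnitary
      simpa [Matrix.star_eq_conjTranspose] using this
    · have := hA.1.spectral_theorem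
      rw [Unitary.conjStarAlgAut_apply] at this
      simpa [Matrix.star_eq_conjTranspose, Function.comp_def] using this
  have hV' : V * Vᵀ = 1 := mul_eq_one_comm.1 hV
  set t : κ → ℝ := fun i => Real.sqrt (1 + d i) - 1 with ht
  have ht0 : ∀ i, 0 ≤ t i := fun i => by
    rw [ht, sub_nonneg, Real.one_le_sqrt]; linarith [hd i]
  refine ⟨V * Matrix.diagonal t * Vᵀ, ?_, ?_⟩
  · simpa using (Matrix.PosSemidef.diagonal ht0).mul_mul_conjTranspose_same V
  · have h1 : ∀ e : κ → ℝ, 1 + V * Matrix.diagonal e * Vᵀ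
        = V * Matrix.diagonal (fun i => 1 + e i) * Vᵀ := fun e => by
      rw [← Matrix.diagonal_add, Matrix.mul_add, Matrix.add_mul, Matrix.diagonal_one,
        Matrix.mul_one, hV']
    rw [hAV, h1, h1]
    have h2 : V * Matrix.diagonal (fun i => 1 + t i) * Vᵀ *
        (V * Matrix.diagonal (fun i => 1 + t i) * Vᵀ)
        = V * (Matrix.diagonal (fun i => 1 + t i) * ((Vᵀ * V) *
          Matrix.diagonal (fun i => 1 + t i))) * Vᵀ := by
      simp only [Matrix.mul_assoc]
    rw [h2, hV, Matrix.one_mul, Matrix.diagonal_mul_diagonal]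
    congr 3
    funext i
    simp only [ht, add_sub_cancel]
    rw [Real.mul_self_sqrt]
    linarith [hd i]

/-- Here `A = T² + 2T` and `⟨T², T⟩ ≥ 0`, so expanding `‖A‖²` leaves at least `4 ‖T‖²`. -/
theorem frobNorm_le_of_one_add_sq {A T : Matrix κ κ ℝ} (hT : T.PosSemidef)
    (h : (1 + T) * (1 + T) = 1 + A) : frobNorm T ≤ frobNorm A := by
  have hTt : Tᵀ = T := by simpa using hT.1.eq
  have hA : A = T * T + (2 : ℝ) • T := by
    have : 1 + A = 1 + (T * T + (2 : ℝ) • T) := by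
      rw [← h, two_smul]; noncomm_ring
    exact add_left_cancel this
  refine le_of_sq_le_sq ?_ (frobNorm_nonneg _)
  have h3 : 0 ≤ frob (T * T) T := trace_mul_gram_nonneg hT T
  rw [frobNorm_sq, frobNorm_sq, hA, frob_add_left, frob_add_right, frob_add_right, frob_smul_left,
    frob_smul_right, frob_smul_left, frob_smul_right, frob_comm T (T * T)]
  nlinarith [frob_self_nonneg (T * T), frob_self_nonneg T]

/-- The factor `B` records that the columns of `Q` lie in the column span of `Z`, so `Q` inherits
orthogonality to the frozen columns. -/
theorem exists_polar {Z : Matrix m κ ℝ} {A : Matrix κ κ ℝ} (hA : A.PosSemidef)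
    (hZ : Zᵀ * Z = 1 + A) :
    ∃ (Q : Matrix m κ ℝ) (T B : Matrix κ κ ℝ), Qᵀ * Q = 1 ∧ T.PosSemidef ∧ Z = Q + Q * T ∧
      Q = Z * B ∧ frobNorm T ≤ frobNorm A := by
  obtain ⟨T, hT, hS⟩ := exists_posSemidef_one_add_sq hA
  have hTt : Tᵀ = T := by simpa using hT.1.eq
  have hpd : (1 + T).PosDef := Matrix.PosDef.one.add_posSemidef hT
  have hu : IsUnit (1 + T).det := (Matrix.isUnit_iff_isUnit_det _).1 hpd.isUnit
  have hinv : (1 + T)⁻¹ * (1 + T) = 1 := Matrix.nonsing_inv_mul _ hu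
  have hinv' : (1 + T) * (1 + T)⁻¹ = 1 := Matrix.mul_nonsing_inv _ hu
  have hSt : ((1 + T)⁻¹)ᵀ = (1 + T)⁻¹ := by
    rw [Matrix.transpose_nonsing_inv, Matrix.transpose_add, hTt, Matrix.transpose_one]
  refine ⟨Z * (1 + T)⁻¹, T, (1 + T)⁻¹, ?_, hT, ?_, rfl, frobNorm_le_of_one_add_sq hT hS⟩
  · rw [Matrix.transpose_mul, hSt, Matrix.mul_assoc, ← Matrix.mul_assoc Zᵀ, hZ, ← hS,
      Matrix.mul_assoc, hinv', Matrix.mul_one, hinv]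
  · conv_lhs => rw [← Matrix.mul_one Z, ← hinv, ← Matrix.mul_assoc, Matrix.mul_add,
      Matrix.mul_one]

/-- The gap between the two sides is `2 ⟨Q T, Q - Y⟩ = ⟨(Q - Y) T, Q - Y⟩ ≥ 0`. The extra `‖Q - Y‖²`
on the left gives uniqueness of the nearest point. -/
theorem polar_nearest {Z Q Y : Matrix m κ ℝ} {T : Matrix κ κ ℝ} (hQ : Qᵀ * Q = 1)
    (hT : T.PosSemidef) (hZ : Z = Q + Q * T) (hY : Yᵀ * Y = 1) :
    frobNorm (Z - Q) ^ 2 + frobNorm (Q - Y) ^ 2 ≤ frobNorm (Z - Y) ^ 2 := by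
  have hTt : Tᵀ = T := by simpa using hT.1.eq
  have h0 := trace_mul_gram_nonneg hT (Q - Y)
  have e1 : Z - Q = Q * T := by rw [hZ, add_sub_cancel_left]
  have e2 : Z - Y = Q * T + (Q - Y) := by rw [hZ]; abel
  have hQY : frob (Y * T) Q = frob (Q * T) Y := by
    rw [frob_mul_right, hTt, frob_comm]
  have hYY : frob (Y * T) Y = frob (Q * T) Q := by
    rw [frob_comm, frob_comm (Q * T), frob, frob, ← Matrix.mul_assoc, ← Matrix.mul_assoc, hQ, hY]
  rw [e1, e2, frobNorm_sq, frobNorm_sq, frobNorm_sq, frob_add_left, frob_add_right,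
    frob_add_right, frob_comm (Q - Y) (Q * T)]
  rw [Matrix.sub_mul, frob_sub_left, frob_sub_right, frob_sub_right, hQY, hYY] at h0
  have h1 : frob (Q * T) (Q - Y) = frob (Q * T) Q - frob (Q * T) Y := frob_sub_right _ _ _
  linarith

end Polar

/-! ### Column selection as matrix multiplication. -/

section Columns

variable {n p : ℕ} (C : Finset (Fin p))

theorem cols_eq_mul (X : Matrix (Fin n) (Fin p) ℝ) : cols X C = X * colSel C := by
  ext i a
  simp [cols, colSel, Matrix.mul_apply, Matrix.one_apply]

theorem colSel_transpose_mul_self : (colSel C)ᵀ * colSel C = 1 := by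
  ext a b
  rw [Matrix.mul_apply, Finset.sum_eq_single (a : Fin p)]
  · simp only [colSel, Matrix.transpose_apply, Matrix.submatrix_apply, id, Matrix.one_apply,
      if_true, one_mul, Subtype.ext_iff]
  · intro c _ hc
    simp [colSel, Matrix.one_apply, hc]
  · simp

theorem colSel_transpose_mul_compl : (colSel C)ᵀ * colSel Cᶜ = 0 := by
  ext a b
  have hb := Finset.mem_compl.1 b.2
  have : (b : Fin p) ≠ a := fun h => hb (h ▸ a.2)
  simp [colSel, Matrix.mul_apply, Matrix.one_apply, this.symm]

theorem colSel_compl_transpose_mul : (colSel Cᶜ)ᵀ * colSel C = 0 := by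
  rw [← Matrix.transpose_transpose (colSel C), ← Matrix.transpose_mul,
    colSel_transpose_mul_compl, Matrix.transpose_zero]

theorem colSel_mul_transpose :
    colSel C * (colSel C)ᵀ = Matrix.diagonal fun a => if a ∈ C then (1 : ℝ) else 0 := by
  ext a b
  rw [Matrix.mul_apply, Matrix.diagonal_apply]
  simp only [colSel, Matrix.submatrix_apply, id, Matrix.transpose_apply, Matrix.one_apply]
  rw [Finset.sum_coe_sort C (fun c => (if a = c then (1 : ℝ) else 0) * if b = c then 1 else 0)]
  by_cases hab : a = b
  · subst hab; simp
  · have : ∀ c, (if a = c then (1 : ℝ) else 0) * (if b = c then 1 else 0) = 0 := fun c => by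
      by_cases h1 : a = c
      · have : ¬ b = c := fun h2 => hab (h1.trans h2.symm)
        simp [this]
      · simp [h1]
    simp [this, hab]

theorem colSel_mul_transpose_add :
    colSel C * (colSel C)ᵀ + colSel Cᶜ * (colSel Cᶜ)ᵀ = 1 := by
  rw [colSel_mul_transpose, colSel_mul_transpose, Matrix.diagonal_add, ← Matrix.diagonal_one]
  congr 1
  funext a
  by_cases h : a ∈ C <;> simp [h]

theorem frobNorm_mul_colSel_transpose (D : Matrix (Fin n) C ℝ) :
    frobNorm (D * (colSel C)ᵀ) = frobNorm D := by
  rw [← frobNorm_transpose, Matrix.transpose_mul, Matrix.transpose_transpose,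
    frobNorm_isometry (colSel_transpose_mul_self C), frobNorm_transpose]

theorem frobNorm_mul_colSel_le (A : Matrix (Fin n) (Fin p) ℝ) :
    frobNorm (A * colSel C) ≤ frobNorm A := by
  rw [← frobNorm_transpose, Matrix.transpose_mul, ← frobNorm_transpose A]
  exact frobNorm_transpose_mul_le (colSel_transpose_mul_self C) _

end Columns

/-! ### One step: explicit search direction and retraction. -/

section Step

variable {n p : ℕ}

/-- The skew-symmetric part of `Xᵀ G`. -/
def skewPart (X G : Matrix (Fin n) (Fin p) ℝ) : Matrix (Fin p) (Fin p) ℝ :=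
  (1 / 2 : ℝ) • (Xᵀ * G - Gᵀ * X)

/-- The search direction on the columns `C`, extended by zero to the other columns. -/
def stepDir (C : Finset (Fin p)) (X G : Matrix (Fin n) (Fin p) ℝ) : Matrix (Fin n) (Fin p) ℝ :=
  ((G - X * (Xᵀ * G)) + X * (colSel C * (colSel C)ᵀ * skewPart X G)) *
    (colSel C * (colSel C)ᵀ)

theorem skewPart_transpose (X G : Matrix (Fin n) (Fin p) ℝ) :
    (skewPart X G)ᵀ = -skewPart X G := by
  rw [skewPart, Matrix.transpose_smul, Matrix.transpose_sub, Matrix.transpose_mul,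
    Matrix.transpose_mul, Matrix.transpose_transpose, Matrix.transpose_transpose, ← smul_neg,
    neg_sub]

variable {C : Finset (Fin p)} {X G : Matrix (Fin n) (Fin p) ℝ}

theorem stepDir_mul_colSel : stepDir C X G * colSel C =
    ((G - X * (Xᵀ * G)) + X * (colSel C * (colSel C)ᵀ * skewPart X G)) * colSel C := by
  rw [stepDir, Matrix.mul_assoc _ (colSel C * (colSel C)ᵀ),
    Matrix.mul_assoc (colSel C) (colSel C)ᵀ (colSel _), colSel_transpose_mul_self, Matrix.mul_one]

theorem stepDir_mul_colSel_mul_transpose :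
    stepDir C X G * colSel C * (colSel C)ᵀ = stepDir C X G := by
  rw [stepDir_mul_colSel, stepDir, Matrix.mul_assoc]

theorem stepDir_mul_colSel_compl : stepDir C X G * colSel Cᶜ = 0 := by
  rw [stepDir, Matrix.mul_assoc _ (colSel C * (colSel C)ᵀ),
    Matrix.mul_assoc (colSel C) (colSel C)ᵀ (colSel _), colSel_transpose_mul_compl, Matrix.mul_zero, Matrix.mul_zero]

theorem transpose_mul_stepDir_mul_colSel (hX : Xᵀ * X = 1) :
    Xᵀ * (stepDir C X G * colSel C) =
      colSel C * ((colSel C)ᵀ * skewPart X G * colSel C) := by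
  rw [stepDir_mul_colSel, ← Matrix.mul_assoc, Matrix.mul_add, Matrix.mul_sub, ← Matrix.mul_assoc Xᵀ,
    hX, Matrix.one_mul, sub_self, zero_add, ← Matrix.mul_assoc, hX, Matrix.one_mul]
  simp only [Matrix.mul_assoc]

theorem stepDir_mem_tangentBlock (hX : Xᵀ * X = 1) :
    stepDir C X G * colSel C ∈ tangentBlock X C := by
  have h := transpose_mul_stepDir_mul_colSel (C := C) (G := G) hX
  have h1 : (cols X C)ᵀ * (stepDir C X G * colSel C) = (colSel C)ᵀ * skewPart X G * colSel C := by
    rw [cols_eq_mul, Matrix.transpose_mul, Matrix.mul_assoc, h, ← Matrix.mul_assoc,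
      colSel_transpose_mul_self, Matrix.one_mul]
  refine ⟨?_, ?_⟩
  · have h2 : (stepDir C X G * colSel C)ᵀ * cols X C
        = ((cols X C)ᵀ * (stepDir C X G * colSel C))ᵀ := by
      rw [Matrix.transpose_mul (cols X C)ᵀ, Matrix.transpose_transpose]
    rw [h2, h1, Matrix.transpose_mul, Matrix.transpose_mul, skewPart_transpose,
      Matrix.transpose_transpose, Matrix.neg_mul, Matrix.mul_neg, Matrix.mul_assoc, neg_add_cancel]
  · rw [cols_eq_mul, Matrix.transpose_mul, Matrix.mul_assoc, h, ← Matrix.mul_assoc,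
      colSel_compl_transpose_mul, Matrix.zero_mul]

theorem frob_symm_skew {κ : Type*} [Fintype κ] {S K : Matrix κ κ ℝ} (hS : Sᵀ = S)
    (hK : Kᵀ = -K) : frob S K = 0 := by
  have h := frob_transpose S K
  rw [hS, hK, frob_neg_right] at h
  linarith

/-- The residual is `X` times a matrix, and `Xᵀ ξ` has only rows in `C` because `ξ` is orthogonal to
the other columns. What is left pairs the symmetric part of the `C`-block of `Xᵀ G` with the skew
matrix `X_Cᵀ ξ`. -/
theorem frob_cols_sub_stepDir {ξ : Matrix (Fin n) C ℝ}
    (hξ : ξ ∈ tangentBlock X C) : frob (cols G C - stepDir C X G * colSel C) ξ = 0 := by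
  obtain ⟨h1, h2⟩ := hξ
  rw [cols_eq_mul] at h1 h2
  have e1 : cols G C - stepDir C X G * colSel C =
      X * ((Xᵀ * G - colSel C * (colSel C)ᵀ * skewPart X G) * colSel C) := by
    rw [cols_eq_mul, stepDir_mul_colSel]
    simp only [Matrix.add_mul, Matrix.sub_mul, Matrix.mul_sub, Matrix.mul_assoc]
    abel
  have e2 : Xᵀ * ξ = colSel C * ((X * colSel C)ᵀ * ξ) := by
    calc Xᵀ * ξ = (colSel C * (colSel C)ᵀ + colSel Cᶜ * (colSel Cᶜ)ᵀ) * (Xᵀ * ξ) := by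
          rw [colSel_mul_transpose_add, Matrix.one_mul]
      _ = colSel C * ((X * colSel C)ᵀ * ξ) + colSel Cᶜ * ((X * colSel Cᶜ)ᵀ * ξ) := by
          simp only [Matrix.add_mul, Matrix.transpose_mul, Matrix.mul_assoc]
      _ = _ := by rw [h2, Matrix.mul_zero, add_zero]
  rw [e1, frob_mul_left, frob_comm, frob_comm, e2, frob_comm, frob_mul_left, frob_comm]
  have e3 : (colSel C)ᵀ * ((Xᵀ * G - colSel C * (colSel C)ᵀ * skewPart X G) * colSel C) =
      (1 / 2 : ℝ) • ((colSel C)ᵀ * (Xᵀ * G + Gᵀ * X) * colSel C) := by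
    have : (colSel C)ᵀ * (colSel C * (colSel C)ᵀ * skewPart X G * colSel C)
        = (colSel C)ᵀ * skewPart X G * colSel C := by
      simp only [← Matrix.mul_assoc, colSel_transpose_mul_self, Matrix.one_mul]
    rw [Matrix.sub_mul, Matrix.mul_sub, this, skewPart, ← Matrix.mul_assoc]
    rw [Matrix.mul_smul, Matrix.smul_mul, ← sub_eq_zero]
    simp only [Matrix.mul_add, Matrix.mul_sub, Matrix.add_mul, Matrix.sub_mul]
    module
  rw [e3, frob_smul_left, frob_symm_skew, mul_zero]
  · simp only [Matrix.transpose_mul, Matrix.transpose_add, Matrix.transpose_transpose,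
      Matrix.mul_add, Matrix.add_mul, Matrix.mul_assoc]
    abel
  · rw [Matrix.transpose_mul, Matrix.transpose_transpose]
    exact eq_neg_of_add_eq_zero_left h1

theorem eq_stepDir_of_mem_projSet (hX : Xᵀ * X = 1) {D : Matrix (Fin n) C ℝ}
    (hD : D ∈ projSet (tangentBlock X C) (cols G C)) : D = stepDir C X G * colSel C := by
  set D₀ := stepDir C X G * colSel C with hD₀
  have hD₀m : D₀ ∈ tangentBlock X C := stepDir_mem_tangentBlock hX
  have h := hD.2 D₀ hD₀m
  have hort : frob (cols G C - D₀) (D₀ - D) = 0 := by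
    rw [frob_sub_right, frob_cols_sub_stepDir hD₀m, frob_cols_sub_stepDir hD.1, sub_zero]
  have e : frobNorm (cols G C - D) ^ 2 = frobNorm (cols G C - D₀) ^ 2 + frobNorm (D₀ - D) ^ 2 := by
    have : cols G C - D = (cols G C - D₀) + (D₀ - D) := by abel
    rw [this, frobNorm_sq, frobNorm_sq, frobNorm_sq, frob_add_left, frob_add_right,
      frob_add_right, frob_comm (D₀ - D), hort]
    ring
  have h2 := pow_le_pow_left₀ (frobNorm_nonneg _) h 2
  have h3 : D₀ - D = 0 := by
    refine frob_self_eq_zero ?_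
    rw [← frobNorm_sq]
    linarith
  exact (sub_eq_zero.1 h3).symm

/-- Orthogonality of the projection gives `‖D‖² = ⟨G_C, D⟩`. -/
theorem frobNorm_stepDir_le (hX : Xᵀ * X = 1) : frobNorm (stepDir C X G) ≤ frobNorm G := by
  have h := frob_cols_sub_stepDir (G := G) (stepDir_mem_tangentBlock (C := C) (G := G) hX)
  have h1 := frob_le (cols G C) (stepDir C X G * colSel C)
  rw [frob_sub_left, sub_eq_zero] at h
  rw [h, ← frobNorm_sq, cols_eq_mul] at h1
  have h2 := frobNorm_mul_colSel_transpose C (stepDir C X G * colSel C)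
  rw [stepDir_mul_colSel_mul_transpose] at h2
  rw [h2]
  have h3 := frobNorm_mul_colSel_le C G
  by_contra! h4
  nlinarith [frobNorm_nonneg G]

theorem eq_of_mul_colSel_eq {A B : Matrix (Fin n) (Fin p) ℝ} (h : A * colSel C = B * colSel C)
    (h' : A * colSel Cᶜ = B * colSel Cᶜ) : A = B := by
  rw [← Matrix.mul_one A, ← Matrix.mul_one B, ← colSel_mul_transpose_add C, Matrix.mul_add,
    Matrix.mul_add, ← Matrix.mul_assoc, ← Matrix.mul_assoc, ← Matrix.mul_assoc,
    ← Matrix.mul_assoc, h, h']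

theorem mem_stiefel_of_colSel {X : Matrix (Fin n) (Fin p) ℝ}
    (h1 : (X * colSel C)ᵀ * (X * colSel C) = 1) (h2 : (X * colSel Cᶜ)ᵀ * (X * colSel C) = 0)
    (h3 : (X * colSel Cᶜ)ᵀ * (X * colSel Cᶜ) = 1) : Xᵀ * X = 1 := by
  have h4 : (X * colSel C)ᵀ * (X * colSel Cᶜ) = 0 := by
    rw [← Matrix.transpose_transpose (X * colSel Cᶜ), ← Matrix.transpose_mul, h2,
      Matrix.transpose_zero]
  simp only [Matrix.transpose_mul, Matrix.mul_assoc] at h1 h2 h3 h4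
  have e : Xᵀ * X * colSel C = colSel C := by
    conv_lhs => rw [← Matrix.one_mul (Xᵀ * X * colSel C), ← colSel_mul_transpose_add C]
    rw [Matrix.add_mul, Matrix.mul_assoc Xᵀ, Matrix.mul_assoc (colSel C),
      Matrix.mul_assoc (colSel Cᶜ), h1, h2, Matrix.mul_one, Matrix.mul_zero, add_zero]
  have e' : Xᵀ * X * colSel Cᶜ = colSel Cᶜ := by
    conv_lhs => rw [← Matrix.one_mul (Xᵀ * X * colSel Cᶜ), ← colSel_mul_transpose_add C]
    rw [Matrix.add_mul, Matrix.mul_assoc Xᵀ, Matrix.mul_assoc (colSel C),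
      Matrix.mul_assoc (colSel Cᶜ), h3, h4, Matrix.mul_one, Matrix.mul_zero, zero_add]
  exact eq_of_mul_colSel_eq (C := C) (by rw [e, Matrix.one_mul]) (by rw [e', Matrix.one_mul])

/-- The step point is the polar factor of the unprojected point. -/
theorem IsStep.exists_spec {γ : ℝ} (hX : Xᵀ * X = 1) :
    ∃ X₁ : Matrix (Fin n) (Fin p) ℝ, X₁ᵀ * X₁ = 1 ∧
      frobNorm (X₁ - (X - γ • stepDir C X G)) ≤ γ ^ 2 * frobNorm (stepDir C X G) ^ 2 ∧
      frobNorm (X₁ - X) ≤ 2 * (|γ| * frobNorm (stepDir C X G)) ∧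
      ∀ X', IsStep γ C X G X' → X' = X₁ := by
  set D := stepDir C X G * colSel C with hD
  set Z := cols X C - γ • D with hZ
  obtain ⟨hD1, hD2⟩ := stepDir_mem_tangentBlock (C := C) (G := G) hX
  have hcc : (cols X C)ᵀ * cols X C = 1 := by
    rw [cols_eq_mul, Matrix.transpose_mul, Matrix.mul_assoc, ← Matrix.mul_assoc Xᵀ, hX,
      Matrix.one_mul, colSel_transpose_mul_self]
  have hcc' : (cols X Cᶜ)ᵀ * cols X Cᶜ = 1 := by
    rw [cols_eq_mul, Matrix.transpose_mul, Matrix.mul_assoc, ← Matrix.mul_assoc Xᵀ, hX,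
      Matrix.one_mul, colSel_transpose_mul_self]
  have hc0 : (cols X Cᶜ)ᵀ * cols X C = 0 := by
    rw [cols_eq_mul, cols_eq_mul, Matrix.transpose_mul, Matrix.mul_assoc, ← Matrix.mul_assoc Xᵀ,
      hX, Matrix.one_mul, colSel_compl_transpose_mul]
  have hDn : frobNorm D = frobNorm (stepDir C X G) := by
    rw [← stepDir_mul_colSel_mul_transpose, frobNorm_mul_colSel_transpose]
  -- Tangency cancels the term linear in `γ`; this is why the retraction error is of second order.
  have hgram : Zᵀ * Z = 1 + γ ^ 2 • (Dᵀ * D) := by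
    have : Zᵀ * Z = (cols X C)ᵀ * cols X C - γ • (Dᵀ * cols X C + (cols X C)ᵀ * D)
        + γ ^ 2 • (Dᵀ * D) := by
      rw [hZ]
      simp only [Matrix.transpose_sub, Matrix.transpose_smul, Matrix.sub_mul, Matrix.mul_sub,
        Matrix.smul_mul, Matrix.mul_smul]
      module
    rw [this, hcc, hD1, smul_zero, sub_zero]
  have hpsd : (γ ^ 2 • (Dᵀ * D)).PosSemidef := by
    have h := Matrix.posSemidef_conjTranspose_mul_self D
    rw [Matrix.conjTranspose_eq_transpose_of_trivial] at h
    exact h.smul (sq_nonneg γ)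
  obtain ⟨Q, T, B, hQ, hT, hZQ, hQB, hTle⟩ := exists_polar hpsd hgram
  have hQ0 : (cols X Cᶜ)ᵀ * Q = 0 := by
    rw [hQB, ← Matrix.mul_assoc, hZ, Matrix.mul_sub, Matrix.mul_smul, hD2, hc0, smul_zero,
      sub_zero, Matrix.zero_mul]
  have hTn : frobNorm T ≤ γ ^ 2 * frobNorm (stepDir C X G) ^ 2 := by
    refine hTle.trans ?_
    rw [frobNorm_smul, abs_of_nonneg (sq_nonneg γ), ← hDn]
    refine mul_le_mul_of_nonneg_left ?_ (sq_nonneg γ)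
    have := frobNorm_mul_le Dᵀ D
    rwa [frobNorm_transpose, ← sq] at this
  set X₁ := Q * (colSel C)ᵀ + cols X Cᶜ * (colSel Cᶜ)ᵀ with hX₁
  have h1 : X₁ * colSel C = Q := by
    rw [hX₁, Matrix.add_mul, Matrix.mul_assoc, Matrix.mul_assoc, colSel_transpose_mul_self,
      colSel_compl_transpose_mul, Matrix.mul_one, Matrix.mul_zero, add_zero]
  have h2 : X₁ * colSel Cᶜ = cols X Cᶜ := by
    rw [hX₁, Matrix.add_mul, Matrix.mul_assoc, Matrix.mul_assoc, colSel_transpose_mul_self,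
      colSel_transpose_mul_compl, Matrix.mul_one, Matrix.mul_zero, zero_add]
  have hdiff : X₁ - (X - γ • stepDir C X G) = (Q - Z) * (colSel C)ᵀ := by
    refine eq_of_mul_colSel_eq (C := C) ?_ ?_
    · rw [Matrix.mul_assoc, colSel_transpose_mul_self, Matrix.mul_one, Matrix.sub_mul, h1,
        Matrix.sub_mul, Matrix.smul_mul, ← cols_eq_mul, hZ]
    · rw [Matrix.mul_assoc, colSel_transpose_mul_compl, Matrix.mul_zero, Matrix.sub_mul, h2,
        Matrix.sub_mul, Matrix.smul_mul, ← cols_eq_mul, stepDir_mul_colSel_compl, smul_zero,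
        sub_zero, sub_self]
  have hQZ : Q - Z = -(Q * T) := by rw [hZQ]; abel
  refine ⟨X₁, ?_, ?_, ?_, ?_⟩
  · refine mem_stiefel_of_colSel (C := C) ?_ ?_ ?_
    · rw [h1, hQ]
    · rw [h1, h2, hQ0]
    · rw [h2, hcc']
  · rw [hdiff, frobNorm_mul_colSel_transpose, hQZ, frobNorm_neg, frobNorm_isometry hQ]
    exact hTn
  -- The old block `X_C` competes in the projection, so `‖Z - Q‖ ≤ ‖Z - X_C‖ = |γ| ‖D‖`; the
  -- triangle inequality then yields the factor 2.
  · have h3 := polar_nearest hQ hT hZQ hcc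
    have h4 : frobNorm (Z - Q) ≤ frobNorm (Z - cols X C) := by
      refine le_of_sq_le_sq ?_ (frobNorm_nonneg _)
      linarith [sq_nonneg (frobNorm (Q - cols X C))]
    have h5 : frobNorm (Z - cols X C) = |γ| * frobNorm (stepDir C X G) := by
      rw [hZ, sub_sub_cancel_left, frobNorm_neg, frobNorm_smul, hDn]
    have h6 : X₁ - X = (X₁ - (X - γ • stepDir C X G)) - γ • stepDir C X G := by abel
    have h7 := frobNorm_sub_le (X₁ - (X - γ • stepDir C X G)) (γ • stepDir C X G)
    rw [← h6, hdiff, frobNorm_mul_colSel_transpose, frobNorm_smul, frobNorm_sub_comm Q] at h7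
    linarith
  · rintro X' ⟨D', hD', hX', hX'c⟩
    rw [eq_stepDir_of_mem_projSet hX hD', ← hD, ← hZ] at hX'
    have h3 := hX'.2 Q ⟨hQ, hQ0⟩
    have h4 := polar_nearest hQ hT hZQ hX'.1.1
    have h5 : Q - cols X' C = 0 := by
      refine frob_self_eq_zero ?_
      rw [← frobNorm_sq]
      have := pow_le_pow_left₀ (frobNorm_nonneg _) h3 2
      linarith
    refine eq_of_mul_colSel_eq (C := C) ?_ ?_
    · rw [h1, ← cols_eq_mul, sub_eq_zero.1 h5]
    · rw [h2, ← cols_eq_mul, hX'c]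

end Step

/-! ### Counting pairs of blocks. -/

section Counting

variable {ℓ : ℕ}

theorem card_blockPair : Fintype.card (BlockPair ℓ) = ℓ.choose 2 := by
  rw [Fintype.card_finset_len, Fintype.card_fin]

theorem sum_blockPair_mem_mem {i j : Fin ℓ} (hij : i ≠ j) :
    ∑ e : BlockPair ℓ, (if i ∈ e.1 then (1 : ℝ) else 0) * (if j ∈ e.1 then 1 else 0) = 1 := by
  rw [Finset.sum_eq_single ⟨{i, j}, Finset.card_pair hij⟩]
  · simp
  · intro e _ he
    by_contra h
    have hi : i ∈ e.1 := by by_contra hi; simp [hi] at h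
    have hj : j ∈ e.1 := by by_contra hj; simp [hj] at h
    refine he (Subtype.ext (Finset.eq_of_subset_of_card_le ?_ ?_).symm)
    · intro a ha
      rcases Finset.mem_insert.1 ha with rfl | ha
      · exact hi
      · rwa [Finset.mem_singleton.1 ha]
    · rw [e.2, Finset.card_pair hij]
  · simp

/-- Double counting of incidences `(j, e)` with `i, j ∈ e`: each pair containing `i` contributes 2,
while `j = i` contributes the unknown sum and every other `j` contributes 1. -/
theorem sum_blockPair_mem (i : Fin ℓ) :
    ∑ e : BlockPair ℓ, (if i ∈ e.1 then (1 : ℝ) else 0) = ℓ - 1 := by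
  have h1 : ∑ j : Fin ℓ, ∑ e : BlockPair ℓ,
      (if i ∈ e.1 then (1 : ℝ) else 0) * (if j ∈ e.1 then 1 else 0)
      = 2 * ∑ e : BlockPair ℓ, (if i ∈ e.1 then (1 : ℝ) else 0) := by
    rw [Finset.sum_comm, Finset.mul_sum]
    refine Finset.sum_congr rfl fun e _ => ?_
    rw [← Finset.mul_sum, mul_comm]
    congr 1
    simp [e.2]
  have h2 : ∑ j : Fin ℓ, ∑ e : BlockPair ℓ,
      (if i ∈ e.1 then (1 : ℝ) else 0) * (if j ∈ e.1 then 1 else 0)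
      = (∑ e : BlockPair ℓ, (if i ∈ e.1 then (1 : ℝ) else 0)) + (ℓ - 1) := by
    rw [← Finset.add_sum_erase _ _ (Finset.mem_univ i)]
    congr 1
    · refine Finset.sum_congr rfl fun e _ => ?_
      split_ifs <;> simp
    · rw [Finset.sum_congr rfl fun j hj => sum_blockPair_mem_mem (Finset.ne_of_mem_erase hj).symm]
      have : 1 ≤ ℓ := i.pos
      simp [Finset.card_erase_of_mem, Nat.cast_sub this]
  linarith

theorem choose_two_cast : ((ℓ.choose 2 : ℕ) : ℝ) = ℓ * (ℓ - 1) / 2 := Nat.cast_choose_two ℝ ℓ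

end Counting

/-! ### The off-diagonal block projection, idempotent and self-adjoint. -/

section OffDiag

variable {κ β : Type*} [DecidableEq β] (b : κ → β)

/-- The off-diagonal blocks of a square matrix, the block of an index `a` being `b a`. -/
def offBlock (M : Matrix κ κ ℝ) : Matrix κ κ ℝ :=
  Matrix.of fun a c => if b a = b c then 0 else M a c

theorem offBlock_add (M K : Matrix κ κ ℝ) :
    offBlock b (M + K) = offBlock b M + offBlock b K := by
  ext a c; simp only [offBlock, Matrix.of_apply, Matrix.add_apply]; split_ifs <;> simp

theorem offBlock_sub (M K : Matrix κ κ ℝ) :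
    offBlock b (M - K) = offBlock b M - offBlock b K := by
  ext a c; simp only [offBlock, Matrix.of_apply, Matrix.sub_apply]; split_ifs <;> simp

theorem offBlock_smul (r : ℝ) (M : Matrix κ κ ℝ) : offBlock b (r • M) = r • offBlock b M := by
  ext a c; simp [offBlock]

theorem offBlock_offBlock (M : Matrix κ κ ℝ) : offBlock b (offBlock b M) = offBlock b M := by
  ext a c; simp only [offBlock, Matrix.of_apply]; split_ifs <;> rfl

theorem offBlock_one [DecidableEq κ] : offBlock b (1 : Matrix κ κ ℝ) = 0 := by
  ext a c
  by_cases h : a = c <;> simp [offBlock, h, Matrix.one_apply]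

theorem offBlock_transpose_mul {m : Type*} [Fintype m] [DecidableEq κ] {X : Matrix m κ ℝ}
    (hX : Xᵀ * X = 1) (Y : Matrix m κ ℝ) : offBlock b (Xᵀ * (Y - X)) = offBlock b (Xᵀ * Y) := by
  rw [Matrix.mul_sub, hX, offBlock_sub, offBlock_one, sub_zero]

variable [Fintype κ]

theorem frob_offBlock_left (M K : Matrix κ κ ℝ) : frob (offBlock b M) K = frob M (offBlock b K) := by
  simp only [frob_eq_sum, offBlock, Matrix.of_apply]
  refine Finset.sum_congr rfl fun a _ => Finset.sum_congr rfl fun c _ => ?_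
  split_ifs <;> simp

theorem frob_offBlock_self (M : Matrix κ κ ℝ) :
    frob (offBlock b M) M = frob (offBlock b M) (offBlock b M) := by
  rw [frob_offBlock_left b M (offBlock b M), offBlock_offBlock, frob_offBlock_left]

theorem frobNorm_offBlock_le (M : Matrix κ κ ℝ) : frobNorm (offBlock b M) ≤ frobNorm M := by
  have h := frob_le (offBlock b M) M
  rw [frob_offBlock_self, ← frobNorm_sq] at h
  by_contra! h2
  nlinarith [frobNorm_nonneg M]

end OffDiag

/-! ### The averaging operator, its inverse and the adaptive metric. -/

section Average

variable {n p ℓ : ℕ} {C : Fin ℓ → Finset (Fin p)} {b : Fin p → Fin ℓ}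

theorem IsBlockPartition.exists_index (hC : IsBlockPartition C) :
    ∃ b : Fin p → Fin ℓ, ∀ a i, a ∈ C i ↔ b a = i := by
  choose b hb using hC.2
  refine ⟨b, fun a i => ⟨fun h => ?_, fun h => h ▸ hb a⟩⟩
  by_contra hne
  exact Finset.disjoint_left.1 (hC.1 _ _ hne) (hb a) h

theorem mem_pairCols (hb : ∀ a i, a ∈ C i ↔ b a = i) (e : BlockPair ℓ) (a : Fin p) :
    a ∈ pairCols C e ↔ b a ∈ e.1 := by
  simp [pairCols, hb]

/-- The coordinate projection on the columns of a pair of blocks. -/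
def pairProj (C : Fin ℓ → Finset (Fin p)) (e : BlockPair ℓ) : Matrix (Fin p) (Fin p) ℝ :=
  colSel (pairCols C e) * (colSel (pairCols C e))ᵀ

theorem pairProj_eq (hb : ∀ a i, a ∈ C i ↔ b a = i) (e : BlockPair ℓ) :
    pairProj C e = Matrix.diagonal fun a => if b a ∈ e.1 then (1 : ℝ) else 0 := by
  simp only [pairProj, colSel_mul_transpose, mem_pairCols hb]

theorem sum_pairProj (hb : ∀ a i, a ∈ C i ↔ b a = i) :
    ∑ e : BlockPair ℓ, pairProj C e = ((ℓ : ℝ) - 1) • 1 := by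
  ext a c
  rw [Matrix.sum_apply, Matrix.smul_apply, Matrix.one_apply]
  simp only [pairProj_eq hb, Matrix.diagonal_apply]
  by_cases h : a = c
  · simp only [h, if_true, sum_blockPair_mem, smul_eq_mul, mul_one]
  · simp [h]

/-- An entry `(a, c)` survives for the pairs containing both of its blocks: `ℓ - 1` pairs if the
blocks agree, exactly one otherwise. -/
theorem sum_pairProj_mul_mul (hb : ∀ a i, a ∈ C i ↔ b a = i) (M : Matrix (Fin p) (Fin p) ℝ) :
    ∑ e : BlockPair ℓ, pairProj C e * M * pairProj C e =
      ((ℓ : ℝ) - 1) • M - ((ℓ : ℝ) - 2) • offBlock b M := by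
  ext a c
  rw [Matrix.sum_apply]
  have h1 : ∀ e : BlockPair ℓ, (pairProj C e * M * pairProj C e) a c =
      (if b a ∈ e.1 then (1 : ℝ) else 0) * (if b c ∈ e.1 then 1 else 0) * M a c := fun e => by
    rw [pairProj_eq hb, Matrix.mul_diagonal, Matrix.diagonal_mul]
    ring
  simp only [h1, ← Finset.sum_mul, Matrix.sub_apply, Matrix.smul_apply, offBlock, Matrix.of_apply,
    smul_eq_mul]
  by_cases h : b a = b c
  · have h2 : ∀ e : BlockPair ℓ, (if b c ∈ e.1 then (1 : ℝ) else 0) * (if b c ∈ e.1 then 1 else 0)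
        = if b c ∈ e.1 then 1 else 0 := fun e => by split_ifs <;> simp
    simp only [h, h2, sum_blockPair_mem, if_true]
    ring
  · rw [sum_blockPair_mem_mem h, if_neg h]
    ring

theorem sum_stepDir (hb : ∀ a i, a ∈ C i ↔ b a = i) (X G : Matrix (Fin n) (Fin p) ℝ) :
    ∑ e : BlockPair ℓ, stepDir (pairCols C e) X G =
      ((ℓ : ℝ) - 1) • (G - X * (Xᵀ * G) + X * skewPart X G) -
        ((ℓ : ℝ) - 2) • (X * offBlock b (skewPart X G)) := by
  have h1 : ∀ e : BlockPair ℓ, stepDir (pairCols C e) X G =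
      (G - X * (Xᵀ * G)) * pairProj C e +
        X * (pairProj C e * skewPart X G * pairProj C e) := fun e => by
    rw [stepDir, Matrix.add_mul, Matrix.mul_assoc X]
    rfl
  simp only [h1]
  rw [Finset.sum_add_distrib, ← Matrix.mul_sum, ← Matrix.mul_sum, sum_pairProj hb,
    sum_pairProj_mul_mul hb, Matrix.mul_smul, Matrix.mul_one, Matrix.mul_sub, Matrix.mul_smul,
    Matrix.mul_smul, smul_add]
  abel

theorem avgOp_apply (hb : ∀ a i, a ∈ C i ↔ b a = i) (X ξ : Matrix (Fin n) (Fin p) ℝ) :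
    avgOp C X ξ = ((ℓ.choose 2 : ℝ))⁻¹ •
      (((ℓ : ℝ) - 1) • ξ - ((ℓ : ℝ) - 2) • (X * offBlock b (Xᵀ * ξ))) := by
  have h0 : avgOp C X ξ = ((ℓ.choose 2 : ℝ))⁻¹ • ∑ e : BlockPair ℓ,
    (1 - cols X (pairCols C e)ᶜ * (cols X (pairCols C e)ᶜ)ᵀ) *
      (cols ξ (pairCols C e) * (colSel (pairCols C e))ᵀ) := rfl
  have h1 : ∀ e : BlockPair ℓ, (1 - cols X (pairCols C e)ᶜ * (cols X (pairCols C e)ᶜ)ᵀ) *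
      (cols ξ (pairCols C e) * (colSel (pairCols C e))ᵀ) =
      (ξ - X * (Xᵀ * ξ)) * pairProj C e +
        X * (pairProj C e * (Xᵀ * ξ) * pairProj C e) := fun e => by
    have h2 : colSel (pairCols C e)ᶜ * (colSel (pairCols C e)ᶜ)ᵀ = 1 - pairProj C e := by
      rw [← colSel_mul_transpose_add (pairCols C e), pairProj, add_sub_cancel_left]
    have h3 : cols X (pairCols C e)ᶜ * (cols X (pairCols C e)ᶜ)ᵀ
        = X * ((1 - pairProj C e) * Xᵀ) := by
      rw [cols_eq_mul, Matrix.transpose_mul, ← h2]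
      simp only [Matrix.mul_assoc]
    have h4 : cols ξ (pairCols C e) * (colSel (pairCols C e))ᵀ = ξ * pairProj C e := by
      rw [cols_eq_mul, Matrix.mul_assoc, pairProj]
    rw [h3, h4]
    simp only [Matrix.sub_mul, Matrix.mul_sub, Matrix.one_mul, Matrix.mul_assoc]
    abel
  rw [h0]
  congr 1
  simp only [h1]
  rw [Finset.sum_add_distrib, ← Matrix.mul_sum, ← Matrix.mul_sum, sum_pairProj hb,
    sum_pairProj_mul_mul hb, Matrix.mul_smul, Matrix.mul_one, Matrix.mul_sub, Matrix.mul_smul,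
    Matrix.mul_smul, smul_sub]
  abel

/-- The explicit inverse of the averaging operator. -/
def avgInv (b : Fin p → Fin ℓ) (X : Matrix (Fin n) (Fin p) ℝ) :
    Matrix (Fin n) (Fin p) ℝ →ₗ[ℝ] Matrix (Fin n) (Fin p) ℝ where
  toFun ξ := ((ℓ : ℝ) / 2) • (ξ + ((ℓ : ℝ) - 2) • (X * offBlock b (Xᵀ * ξ)))
  map_add' ξ η := by
    rw [Matrix.mul_add, offBlock_add, Matrix.mul_add]
    module
  map_smul' c ξ := by
    rw [Matrix.mul_smul, offBlock_smul, Matrix.mul_smul, RingHom.id_apply]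
    module

/-- For orthonormal `X` the map `ξ ↦ X offBlock(Xᵀ ξ)` is idempotent. `A_X` acts as `(ℓ choose 2)⁻¹`
on its range and as `2 / ℓ` on its kernel; `avgInv` has the reciprocal factors. -/
theorem avgOp_mul_avgInv (hℓ : 2 ≤ ℓ) (hb : ∀ a i, a ∈ C i ↔ b a = i)
    {X : Matrix (Fin n) (Fin p) ℝ} (hX : Xᵀ * X = 1) : avgOp C X * avgInv b X = 1 := by
  refine LinearMap.ext fun ξ => ?_
  have hl : (2 : ℝ) ≤ ℓ := by exact_mod_cast hℓ
  have h0 : avgInv b X ξ = ((ℓ : ℝ) / 2) • (ξ + ((ℓ : ℝ) - 2) • (X * offBlock b (Xᵀ * ξ))) := rfl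
  have h1 : offBlock b (Xᵀ * avgInv b X ξ) = ((ℓ : ℝ) / 2 * (ℓ - 1)) • offBlock b (Xᵀ * ξ) := by
    rw [h0, Matrix.mul_smul, Matrix.mul_add, Matrix.mul_smul, ← Matrix.mul_assoc Xᵀ X, hX,
      Matrix.one_mul, offBlock_smul, offBlock_add, offBlock_smul, offBlock_offBlock]
    module
  rw [Module.End.mul_apply, avgOp_apply hb, h1, h0, choose_two_cast, Module.End.one_apply,
    Matrix.mul_smul]
  have h2 : (ℓ : ℝ) * (ℓ - 1) / 2 ≠ 0 := by
    have : 0 < (ℓ : ℝ) * (ℓ - 1) := mul_pos (by linarith) (by linarith)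
    positivity
  rw [inv_smul_eq_iff₀ h2]
  module

theorem inverse_avgOp (hℓ : 2 ≤ ℓ) (hb : ∀ a i, a ∈ C i ↔ b a = i)
    {X : Matrix (Fin n) (Fin p) ℝ} (hX : Xᵀ * X = 1) :
    Ring.inverse (avgOp C X) = avgInv b X := by
  have h1 := avgOp_mul_avgInv hℓ hb hX
  -- `Ring.inverse` is zero off the units, so a two-sided inverse is needed; in finite dimension one
  -- side suffices.
  have h2 : avgInv b X * avgOp C X = 1 := mul_eq_one_comm.1 h1
  exact Ring.inverse_unit ⟨avgOp C X, avgInv b X, h1, h2⟩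

/-- The squared adaptive norm of `Y - X`, for `X` with orthonormal columns. -/
def proxDist (b : Fin p → Fin ℓ) (Y X : Matrix (Fin n) (Fin p) ℝ) : ℝ :=
  (ℓ : ℝ) / 2 * (frobNorm (Y - X) ^ 2 + ((ℓ : ℝ) - 2) * frobNorm (offBlock b (Xᵀ * Y)) ^ 2)

theorem le_proxDist (hℓ : 2 ≤ ℓ) (Y X : Matrix (Fin n) (Fin p) ℝ) :
    (ℓ : ℝ) / 2 * frobNorm (Y - X) ^ 2 ≤ proxDist b Y X := by
  have hl : (0 : ℝ) ≤ ℓ - 2 := sub_nonneg.2 (by exact_mod_cast hℓ)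
  refine mul_le_mul_of_nonneg_left ?_ (by positivity)
  exact le_add_of_nonneg_right (mul_nonneg hl (sq_nonneg _))

theorem proxDist_nonneg (hℓ : 2 ≤ ℓ) (Y X : Matrix (Fin n) (Fin p) ℝ) : 0 ≤ proxDist b Y X :=
  (by positivity : (0 : ℝ) ≤ (ℓ : ℝ) / 2 * frobNorm (Y - X) ^ 2).trans (le_proxDist hℓ Y X)

theorem proxDist_self {X : Matrix (Fin n) (Fin p) ℝ} (hX : Xᵀ * X = 1) : proxDist b X X = 0 := by
  simp [proxDist, hX, offBlock_one]

theorem continuous_proxDist (X : Matrix (Fin n) (Fin p) ℝ) :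
    Continuous fun Y => proxDist b Y X := by
  have h1 : Continuous fun Y : Matrix (Fin n) (Fin p) ℝ => offBlock b (Xᵀ * Y) := by
    refine continuous_matrix fun a c => ?_
    simp only [offBlock, Matrix.of_apply]
    split_ifs
    · exact continuous_const
    · fun_prop
  exact continuous_const.mul (((continuous_frobNorm.comp (continuous_id.sub continuous_const)).pow
    2).add (continuous_const.mul ((continuous_frobNorm.comp h1).pow 2)))

theorem adaptiveNorm_eq (hℓ : 2 ≤ ℓ) (hb : ∀ a i, a ∈ C i ↔ b a = i)
    {X : Matrix (Fin n) (Fin p) ℝ} (hX : Xᵀ * X = 1) (Y : Matrix (Fin n) (Fin p) ℝ) :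
    adaptiveNorm C X (Y - X) = Real.sqrt (proxDist b Y X) := by
  have h0 : avgInv b X (Y - X) = ((ℓ : ℝ) / 2) •
    ((Y - X) + ((ℓ : ℝ) - 2) • (X * offBlock b (Xᵀ * (Y - X)))) := rfl
  rw [adaptiveNorm, inverse_avgOp hℓ hb hX, h0, frob_smul_left, frob_add_left, frob_smul_left,
    frob_mul_left, frob_offBlock_self, offBlock_transpose_mul b hX, proxDist, frobNorm_sq,
    frobNorm_sq]

theorem adaptiveNorm_sq (hℓ : 2 ≤ ℓ) (hb : ∀ a i, a ∈ C i ↔ b a = i)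
    {X : Matrix (Fin n) (Fin p) ℝ} (hX : Xᵀ * X = 1) (Y : Matrix (Fin n) (Fin p) ℝ) :
    adaptiveNorm C X (Y - X) ^ 2 = proxDist b Y X := by
  rw [adaptiveNorm_eq hℓ hb hX, Real.sq_sqrt (proxDist_nonneg hℓ Y X)]

end Average

/-! ### The Riemannian subgradient on the Stiefel manifold. -/

section RiemannianGradient

variable {n p : ℕ} {X G : Matrix (Fin n) (Fin p) ℝ}

/-- The projection of `G` onto the tangent space of the Stiefel manifold at `X`. -/
def riemGrad (X G : Matrix (Fin n) (Fin p) ℝ) : Matrix (Fin n) (Fin p) ℝ :=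
  G - X * (Xᵀ * G) + X * skewPart X G

theorem transpose_mul_riemGrad (hX : Xᵀ * X = 1) : Xᵀ * riemGrad X G = skewPart X G := by
  rw [riemGrad, Matrix.mul_add, Matrix.mul_sub, ← Matrix.mul_assoc Xᵀ, hX, Matrix.one_mul,
    sub_self, zero_add, ← Matrix.mul_assoc, hX, Matrix.one_mul]

theorem sub_skewPart_transpose :
    (Xᵀ * G - skewPart X G)ᵀ = Xᵀ * G - skewPart X G := by
  rw [Matrix.transpose_sub, skewPart_transpose, Matrix.transpose_mul, Matrix.transpose_transpose,
    skewPart]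
  module

theorem frobNorm_riemGrad_le (hX : Xᵀ * X = 1) : frobNorm (riemGrad X G) ≤ frobNorm G := by
  have h0 : frob (G - riemGrad X G) (riemGrad X G) = 0 := by
    have : G - riemGrad X G = X * (Xᵀ * G - skewPart X G) := by
      rw [riemGrad, Matrix.mul_sub]; abel
    rw [this, frob_mul_left, transpose_mul_riemGrad hX]
    exact frob_symm_skew sub_skewPart_transpose (skewPart_transpose X G)
  have h1 := frob_le G (riemGrad X G)
  rw [frob_sub_left, sub_eq_zero] at h0
  rw [h0, ← frobNorm_sq] at h1
  by_contra! h
  nlinarith [frobNorm_nonneg G]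

theorem frobNorm_sub_skewPart_le (hX : Xᵀ * X = 1) :
    frobNorm (Xᵀ * G - skewPart X G) ≤ frobNorm G := by
  refine le_trans ?_ (frobNorm_transpose_mul_le hX G)
  have h0 := frob_symm_skew (sub_skewPart_transpose (X := X) (G := G)) (skewPart_transpose X G)
  refine le_of_sq_le_sq ?_ (frobNorm_nonneg _)
  have h1 : frob (Xᵀ * G) (Xᵀ * G) = frob (Xᵀ * G - skewPart X G) (Xᵀ * G - skewPart X G) +
      2 * frob (Xᵀ * G - skewPart X G) (skewPart X G) + frob (skewPart X G) (skewPart X G) := by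
    simp only [frob_sub_left, frob_sub_right, frob_comm (skewPart X G) (Xᵀ * G)]
    ring
  rw [frobNorm_sq, frobNorm_sq, h1, h0]
  linarith [frob_self_nonneg (skewPart X G)]

/-- The normal part of `G` is `X S` with `S` symmetric. For two Stiefel points the symmetric part of
`Xᵀ Y - 1` is `-(Y - X)ᵀ (Y - X) / 2`, so discarding the normal part costs only a quadratic term. -/
theorem frob_riemGrad_le (hX : Xᵀ * X = 1) {Y : Matrix (Fin n) (Fin p) ℝ} (hY : Yᵀ * Y = 1) :
    frob (riemGrad X G) Y ≤ frob G (Y - X) + frobNorm G / 2 * frobNorm (Y - X) ^ 2 := by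
  set S := Xᵀ * G - skewPart X G with hS
  have hSt : Sᵀ = S := sub_skewPart_transpose
  have h1 : frob (riemGrad X G) X = 0 := by
    rw [frob_comm]
    have h := frob_mul_left X (1 : Matrix (Fin p) (Fin p) ℝ) (riemGrad X G)
    rw [Matrix.mul_one, transpose_mul_riemGrad hX] at h
    rw [h]
    exact frob_symm_skew Matrix.transpose_one (skewPart_transpose X G)
  have h2 : frob (riemGrad X G) Y = frob G (Y - X) - frob S (Xᵀ * Y - 1) := by
    have e : riemGrad X G = G - X * S := by
      rw [riemGrad, hS, Matrix.mul_sub]; abel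
    have e2 : frob (riemGrad X G) Y = frob (riemGrad X G) (Y - X) := by
      rw [frob_sub_right, h1, sub_zero]
    rw [e2, e, frob_sub_left, frob_mul_left, Matrix.mul_sub, hX]
  have h3 : frob S ((Y - X)ᵀ * (Y - X)) = -2 * frob S (Xᵀ * Y - 1) := by
    have e : (Y - X)ᵀ * (Y - X) = -((Xᵀ * Y - 1) + (Xᵀ * Y - 1)ᵀ) := by
      simp only [Matrix.transpose_sub, Matrix.transpose_mul, Matrix.transpose_transpose,
        Matrix.transpose_one, Matrix.sub_mul, Matrix.mul_sub, hX, hY]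
      abel
    have e2 : frob S (Xᵀ * Y - 1)ᵀ = frob S (Xᵀ * Y - 1) := by
      rw [← frob_transpose S (Xᵀ * Y - 1), hSt]
    rw [e, frob_neg_right, frob_add_right, e2]
    ring
  have h4 : frob S ((Y - X)ᵀ * (Y - X)) ≤ frobNorm G * frobNorm (Y - X) ^ 2 := by
    refine (frob_le _ _).trans ?_
    refine mul_le_mul (frobNorm_sub_skewPart_le hX) ?_ (frobNorm_nonneg _) (frobNorm_nonneg _)
    have := frobNorm_mul_le (Y - X)ᵀ (Y - X)
    rwa [frobNorm_transpose, ← sq] at this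
  linarith

end RiemannianGradient

/-! ### Change of the adaptive distance along a step. -/

section Descent

variable {n p ℓ : ℕ} {C : Fin ℓ → Finset (Fin p)} {b : Fin p → Fin ℓ}
  {X Y G : Matrix (Fin n) (Fin p) ℝ}

/-- The derivative of `X ↦ -proxDist b Y X` in the tangent direction `H`. -/
def proxSlope (b : Fin p → Fin ℓ) (X Y H : Matrix (Fin n) (Fin p) ℝ) : ℝ :=
  ℓ * (frob H Y - ((ℓ : ℝ) - 2) * frob (offBlock b (Xᵀ * Y)) (Hᵀ * Y))

theorem proxSlope_sum {α : Type*} (s : Finset α) (H : α → Matrix (Fin n) (Fin p) ℝ) :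
    proxSlope b X Y (∑ e ∈ s, H e) = ∑ e ∈ s, proxSlope b X Y (H e) := by
  simp only [proxSlope]
  rw [← Finset.mul_sum, Finset.sum_sub_distrib, ← Finset.mul_sum, frob_sum_left,
    Matrix.transpose_sum, Matrix.sum_mul, frob_comm (offBlock b (Xᵀ * Y)), frob_sum_left]
  simp only [frob_comm (offBlock b (Xᵀ * Y))]

theorem proxDist_eq (hX : Xᵀ * X = 1) (hY : Yᵀ * Y = 1) :
    proxDist b Y X = ℓ * (p - frob X Y) +
      (ℓ : ℝ) * (ℓ - 2) / 2 * frobNorm (offBlock b (Xᵀ * Y)) ^ 2 := by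
  have h1 := frobNorm_stiefel (Q := X) hX
  have h2 := frobNorm_stiefel (Q := Y) hY
  rw [frobNorm_sq, Fintype.card_fin] at h1 h2
  have h3 : frobNorm (Y - X) ^ 2 = 2 * (p - frob X Y) := by
    rw [frobNorm_sq, frob_sub_left, frob_sub_right, frob_sub_right, h1, h2, frob_comm Y X]
    ring
  rw [proxDist, h3]
  ring

/-- The sum is `(ℓ - 1) - (ℓ - 2) Π` applied to the Riemannian subgradient, with `Π` the orthogonal
projection `ξ ↦ X offBlock(Xᵀ ξ)`; this operator has norm at most `ℓ - 1`. -/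
theorem frobNorm_sum_stepDir_le (hℓ : 2 ≤ ℓ) (hb : ∀ a i, a ∈ C i ↔ b a = i) (hX : Xᵀ * X = 1) :
    frobNorm (∑ e : BlockPair ℓ, stepDir (pairCols C e) X G) ≤ ((ℓ : ℝ) - 1) * frobNorm G := by
  have hl : (2 : ℝ) ≤ ℓ := by exact_mod_cast hℓ
  rw [sum_stepDir hb]
  change frobNorm (((ℓ : ℝ) - 1) • riemGrad X G -
    ((ℓ : ℝ) - 2) • (X * offBlock b (skewPart X G))) ≤ _
  refine le_trans ?_ (mul_le_mul_of_nonneg_left (frobNorm_riemGrad_le hX) (by linarith))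
  refine le_of_sq_le_sq ?_ (mul_nonneg (by linarith) (frobNorm_nonneg _))
  have h1 : frob (riemGrad X G) (X * offBlock b (skewPart X G)) =
      frobNorm (offBlock b (skewPart X G)) ^ 2 := by
    rw [frob_comm, frob_mul_left, transpose_mul_riemGrad hX, frob_offBlock_self, frobNorm_sq]
  have h2 : frob (X * offBlock b (skewPart X G)) (X * offBlock b (skewPart X G)) =
      frobNorm (offBlock b (skewPart X G)) ^ 2 := by
    rw [frob_isometry hX, frobNorm_sq]
  rw [frobNorm_sq]
  simp only [frob_sub_left, frob_sub_right, frob_smul_left, frob_smul_right]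
  rw [frob_comm (X * offBlock b (skewPart X G)) (riemGrad X G), h1, h2, mul_pow,
    frobNorm_sq (riemGrad X G)]
  have h3 : 0 ≤ ((ℓ : ℝ) - 2) * ℓ * frobNorm (offBlock b (skewPart X G)) ^ 2 :=
    mul_nonneg (mul_nonneg (by linarith) (by linarith)) (sq_nonneg _)
  nlinarith

/-- The off-diagonal term of `⟨S, Y⟩` cancels against the `Sᵀ X` part of the metric derivative: this
is `A_X⁻¹` meeting `A_X`. The constant `(2ℓ - 3)/2` is `1/2` from curvature plus `ℓ - 2` from the
variation of the metric. -/
theorem sum_proxSlope_le (hℓ : 2 ≤ ℓ) (hb : ∀ a i, a ∈ C i ↔ b a = i) (hX : Xᵀ * X = 1)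
    (hY : Yᵀ * Y = 1) {L : ℝ} (hG : frobNorm G ≤ L) :
    ∑ e : BlockPair ℓ, proxSlope b X Y (stepDir (pairCols C e) X G) ≤
      ℓ * (ℓ - 1) * (frob G (Y - X) + (2 * ℓ - 3) / 2 * L * frobNorm (Y - X) ^ 2) := by
  have hl : (2 : ℝ) ≤ ℓ := by exact_mod_cast hℓ
  rw [← proxSlope_sum]
  set S := ∑ e : BlockPair ℓ, stepDir (pairCols C e) X G with hS
  set K := skewPart X G with hK
  have hSn : frobNorm S ≤ ((ℓ : ℝ) - 1) * L :=
    (frobNorm_sum_stepDir_le hℓ hb hX).trans (mul_le_mul_of_nonneg_left hG (by linarith))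
  have hSe : S = ((ℓ : ℝ) - 1) • riemGrad X G - ((ℓ : ℝ) - 2) • (X * offBlock b K) :=
    sum_stepDir hb X G
  have h1 : frob S Y = (ℓ - 1) * frob (riemGrad X G) Y -
      (ℓ - 2) * frob (offBlock b K) (Xᵀ * Y) := by
    rw [hSe, frob_sub_left, frob_smul_left, frob_smul_left, frob_mul_left]
  have hXS : Xᵀ * S = ((ℓ : ℝ) - 1) • K - ((ℓ : ℝ) - 2) • offBlock b K := by
    rw [hSe, Matrix.mul_sub, Matrix.mul_smul, Matrix.mul_smul, transpose_mul_riemGrad hX,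
      ← Matrix.mul_assoc, hX, Matrix.one_mul]
  have hKt : Kᵀ = -K := skewPart_transpose X G
  have hKot : (offBlock b K)ᵀ = -offBlock b K := by
    ext a c
    have := congrFun (congrFun hKt a) c
    simp only [Matrix.transpose_apply, Matrix.neg_apply] at this
    simp only [offBlock, Matrix.transpose_apply, Matrix.of_apply, Matrix.neg_apply, this,
      eq_comm (a := b c)]
    split_ifs <;> simp
  have hSX : Sᵀ * X = -(((ℓ : ℝ) - 1) • K - ((ℓ : ℝ) - 2) • offBlock b K) := by
    have : Sᵀ * X = (Xᵀ * S)ᵀ := by rw [Matrix.transpose_mul, Matrix.transpose_transpose]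
    rw [this, hXS, Matrix.transpose_sub, Matrix.transpose_smul, Matrix.transpose_smul, hKt, hKot]
    module
  have h2 : frob (offBlock b (Xᵀ * Y)) (Sᵀ * X) = -frob (offBlock b K) (Xᵀ * Y) := by
    have e : frob (offBlock b (Xᵀ * Y)) (offBlock b K) = frob (offBlock b K) (Xᵀ * Y) := by
      rw [← frob_offBlock_left, offBlock_offBlock, frob_offBlock_left, frob_comm]
    have e' : frob (offBlock b (Xᵀ * Y)) K = frob (offBlock b K) (Xᵀ * Y) := by
      rw [frob_offBlock_left, frob_comm]
    rw [hSX, frob_neg_right, frob_sub_right, frob_smul_right, frob_smul_right, e, e']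
    ring
  have h3 : frob (offBlock b (Xᵀ * Y)) (Sᵀ * Y) =
      frob (offBlock b (Xᵀ * Y)) (Sᵀ * (Y - X)) - frob (offBlock b K) (Xᵀ * Y) := by
    have : Sᵀ * Y = Sᵀ * (Y - X) + Sᵀ * X := by rw [Matrix.mul_sub, sub_add_cancel]
    rw [this, frob_add_right, h2]
    ring
  have h4 : -frob (offBlock b (Xᵀ * Y)) (Sᵀ * (Y - X)) ≤
      (ℓ - 1) * L * frobNorm (Y - X) ^ 2 := by
    refine (neg_le_abs _).trans ((abs_frob_le _ _).trans ?_)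
    have e1 : frobNorm (offBlock b (Xᵀ * Y)) ≤ frobNorm (Y - X) := by
      rw [← offBlock_transpose_mul b hX]
      exact (frobNorm_offBlock_le b _).trans (frobNorm_transpose_mul_le hX _)
    have e2 : frobNorm (Sᵀ * (Y - X)) ≤ (ℓ - 1) * L * frobNorm (Y - X) := by
      refine (frobNorm_mul_le _ _).trans ?_
      rw [frobNorm_transpose]
      exact mul_le_mul_of_nonneg_right hSn (frobNorm_nonneg _)
    calc _ ≤ frobNorm (Y - X) * ((ℓ - 1) * L * frobNorm (Y - X)) :=
          mul_le_mul e1 e2 (frobNorm_nonneg _) (frobNorm_nonneg _)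
      _ = _ := by ring
  have h5 : frob (riemGrad X G) Y ≤ frob G (Y - X) + L / 2 * frobNorm (Y - X) ^ 2 := by
    refine (frob_riemGrad_le hX hY).trans ?_
    have := mul_le_mul_of_nonneg_right hG (sq_nonneg (frobNorm (Y - X)))
    linarith
  have h6 : frob S Y - (ℓ - 2) * frob (offBlock b (Xᵀ * Y)) (Sᵀ * Y) ≤
      (ℓ - 1) * (frob G (Y - X) + (2 * ℓ - 3) / 2 * L * frobNorm (Y - X) ^ 2) := by
    rw [h1, h3]
    have e1 := mul_le_mul_of_nonneg_left h4 (by linarith : (0 : ℝ) ≤ ℓ - 2)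
    have e2 := mul_le_mul_of_nonneg_left h5 (by linarith : (0 : ℝ) ≤ ℓ - 1)
    nlinarith
  rw [proxSlope, mul_assoc]
  exact mul_le_mul_of_nonneg_left h6 (by linarith)

/-- The constant of the quadratic term in the change of `proxDist` along a step. -/
def stepConst (p ℓ : ℕ) (L : ℝ) : ℝ :=
  ℓ * L ^ 2 * ((ℓ - 1) * Real.sqrt p + 2 * (ℓ - 2))

/-- Between Stiefel points `‖Y - X‖²` is affine in `X`, so the only quadratic term is that of the
off-diagonal part. The retraction error `R` is itself of order `γ²`. -/
theorem proxDist_step_le (hℓ : 2 ≤ ℓ) (hX : Xᵀ * X = 1) (hY : Yᵀ * Y = 1)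
    {X₁ H : Matrix (Fin n) (Fin p) ℝ} (hX₁ : X₁ᵀ * X₁ = 1) {γ L : ℝ}
    (hH : frobNorm H ≤ L) (h1 : frobNorm (X₁ - (X - γ • H)) ≤ γ ^ 2 * frobNorm H ^ 2)
    (h2 : frobNorm (X₁ - X) ≤ 2 * (|γ| * frobNorm H)) :
    proxDist b Y X₁ ≤ proxDist b Y X + γ * proxSlope b X Y H + γ ^ 2 * stepConst p ℓ L := by
  have hl : (2 : ℝ) ≤ ℓ := by exact_mod_cast hℓ
  set R := X₁ - (X - γ • H) with hR
  set O := offBlock b (Xᵀ * Y) with hO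
  have hYn : frobNorm Y = Real.sqrt p := by
    have := frobNorm_stiefel (Q := Y) hY
    rw [Fintype.card_fin] at this
    rw [← this, Real.sqrt_sq (frobNorm_nonneg _)]
  have hsp := Real.sqrt_nonneg (p : ℝ)
  have hH2 : frobNorm H ^ 2 ≤ L ^ 2 := pow_le_pow_left₀ (frobNorm_nonneg _) hH 2
  have hRn : frobNorm R ≤ γ ^ 2 * L ^ 2 := h1.trans (mul_le_mul_of_nonneg_left hH2 (sq_nonneg _))
  have hmul : ∀ A : Matrix (Fin n) (Fin p) ℝ, frobNorm (Aᵀ * Y) ≤ frobNorm A := fun A => by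
    have e : Aᵀ * Y = (Yᵀ * A)ᵀ := by rw [Matrix.transpose_mul, Matrix.transpose_transpose]
    rw [e, frobNorm_transpose]
    exact frobNorm_transpose_mul_le hY A
  have hdn : frobNorm (offBlock b ((X₁ - X)ᵀ * Y)) ^ 2 ≤ 4 * (γ ^ 2 * L ^ 2) := by
    have e : frobNorm (offBlock b ((X₁ - X)ᵀ * Y)) ≤ 2 * (|γ| * frobNorm H) :=
      (frobNorm_offBlock_le b _).trans ((hmul _).trans h2)
    have e2 := pow_le_pow_left₀ (frobNorm_nonneg _) e 2
    rw [mul_pow, mul_pow, sq_abs] at e2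
    nlinarith [mul_le_mul_of_nonneg_left hH2 (sq_nonneg γ)]
  have hOn : frobNorm O ≤ Real.sqrt p := by
    rw [← hYn]
    exact (frobNorm_offBlock_le b _).trans (frobNorm_transpose_mul_le hX Y)
  have hXX : X₁ - X = R - γ • H := by rw [hR]; abel
  have hsq : frobNorm (offBlock b (X₁ᵀ * Y)) ^ 2 = frobNorm O ^ 2 + 2 * frob O ((X₁ - X)ᵀ * Y) +
      frobNorm (offBlock b ((X₁ - X)ᵀ * Y)) ^ 2 := by
    have e : offBlock b (X₁ᵀ * Y) = O + offBlock b ((X₁ - X)ᵀ * Y) := by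
      rw [hO, ← offBlock_add, Matrix.transpose_sub, Matrix.sub_mul, add_sub_cancel]
    have e2 : frob O ((X₁ - X)ᵀ * Y) = frob O (offBlock b ((X₁ - X)ᵀ * Y)) := by
      rw [← frob_offBlock_left, hO, offBlock_offBlock]
    rw [e, e2, frobNorm_sq, frobNorm_sq, frobNorm_sq, frob_add_left, frob_add_right,
      frob_add_right, frob_comm (offBlock b ((X₁ - X)ᵀ * Y)) O]
    ring
  have hlin : frob X₁ Y = frob X Y + frob R Y - γ * frob H Y := by
    have e : X₁ = X + (R - γ • H) := by rw [← hXX]; abel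
    rw [e, frob_add_left, frob_sub_left, frob_smul_left]
    ring
  have hlin2 : frob O ((X₁ - X)ᵀ * Y) = frob O (Rᵀ * Y) - γ * frob O (Hᵀ * Y) := by
    rw [hXX, Matrix.transpose_sub, Matrix.sub_mul, frob_sub_right, Matrix.transpose_smul,
      Matrix.smul_mul, frob_smul_right]
  have hb1 : -frob R Y ≤ γ ^ 2 * L ^ 2 * Real.sqrt p := by
    refine (neg_le_abs _).trans ((abs_frob_le _ _).trans ?_)
    rw [hYn]
    exact mul_le_mul_of_nonneg_right hRn hsp
  have hb2 : frob O (Rᵀ * Y) ≤ γ ^ 2 * L ^ 2 * Real.sqrt p := by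
    refine (frob_le _ _).trans ?_
    rw [mul_comm]
    exact mul_le_mul ((hmul R).trans hRn) hOn (frobNorm_nonneg _) (by positivity)
  rw [proxDist_eq hX₁ hY, proxDist_eq hX hY, hsq, hlin, hlin2, proxSlope, stepConst, ← hO]
  -- `c1` and `c2` add up to the `(ℓ - 1) √p` part of `stepConst`, and `c3` gives its `2 (ℓ - 2)`
  -- part.
  have c1 := mul_le_mul_of_nonneg_left hb1 (by linarith : (0 : ℝ) ≤ ℓ)
  have c2 := mul_le_mul_of_nonneg_left hb2
    (mul_nonneg (by linarith) (by linarith) : (0 : ℝ) ≤ ℓ * (ℓ - 2))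
  have c3 := mul_le_mul_of_nonneg_left hdn
    (mul_nonneg (by linarith) (by linarith) : (0 : ℝ) ≤ ℓ * (ℓ - 2))
  nlinarith

end Descent

/-! ### Descent of the envelope, averaged over the pairs. -/

section Envelope

variable {n p ℓ : ℕ} {C : Fin ℓ → Finset (Fin p)} {f : Matrix (Fin n) (Fin p) ℝ → ℝ}
  {U : Set (Matrix (Fin n) (Fin p) ℝ)} {τ L lam : ℝ} {X G : Matrix (Fin n) (Fin p) ℝ}

/-- The value of the adaptive proximal problem at `X`. -/
def envelope (f : Matrix (Fin n) (Fin p) ℝ → ℝ) (C : Fin ℓ → Finset (Fin p)) (lam : ℝ)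
    (X : Matrix (Fin n) (Fin p) ℝ) : ℝ :=
  f (adaptiveProx f C lam X) + 1 / (2 * lam) * adaptiveNorm C X (adaptiveProx f C lam X - X) ^ 2

theorem continuousOn_stiefel (hU : U ∈ 𝓝ˢ (stiefel (Fin n) (Fin p)))
    (hlip : FrobLipschitzOn L U f) : ContinuousOn f (stiefel (Fin n) (Fin p)) := fun X hX =>
  (continuousAt_of_frobLipschitzOn hlip (mem_nhdsSet_iff_forall.1 hU X hX)).continuousWithinAt

/-- Compactness supplies a minimizer, so the epsilon choice is one; the argument works with any
minimizer and does not need uniqueness. -/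
theorem adaptiveProx_mem (hℓ : 2 ≤ ℓ) (hC : IsBlockPartition C)
    (hcont : ContinuousOn f (stiefel (Fin n) (Fin p))) (hX : X ∈ stiefel (Fin n) (Fin p)) :
    adaptiveProx f C lam X ∈ adaptiveProxSet f C lam X := by
  obtain ⟨b, hb⟩ := hC.exists_index
  refine Classical.epsilon_spec (p := fun Y => Y ∈ adaptiveProxSet f C lam X) ?_
  obtain ⟨Y, hY, hmin⟩ := isCompact_stiefel.exists_isMinOn ⟨X, hX⟩
    (hcont.add (((continuous_proxDist (b := b) X).const_mul (1 / (2 * lam))).continuousOn))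
  refine ⟨Y, hY, fun Z hZ => ?_⟩
  rw [adaptiveNorm_sq hℓ hb hX, adaptiveNorm_sq hℓ hb hX]
  exact hmin hZ

theorem sq_surrogateMeasure (X : Matrix (Fin n) (Fin p) ℝ) : surrogateMeasure f C lam X ^ 2 =
    adaptiveNorm C X (adaptiveProx f C lam X - X) ^ 2 / lam ^ 2 := by
  rw [surrogateMeasure, mul_pow]
  ring

theorem exists_le_envelope (hℓ : 2 ≤ ℓ) (hC : IsBlockPartition C) (hlam : 0 < lam)
    (hcont : ContinuousOn f (stiefel (Fin n) (Fin p))) :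
    ∃ m : ℝ, ∀ X ∈ stiefel (Fin n) (Fin p), m ≤ envelope f C lam X := by
  obtain ⟨m, hm⟩ := (isCompact_stiefel.image_of_continuousOn hcont).bddBelow
  refine ⟨m, fun X hX => ?_⟩
  have h1 := hm (Set.mem_image_of_mem f
    (adaptiveProx_mem (lam := lam) hℓ hC hcont hX).1)
  have h2 : 0 ≤ 1 / (2 * lam) * adaptiveNorm C X (adaptiveProx f C lam X - X) ^ 2 := by positivity
  rw [envelope]
  linarith

theorem sum_envelope_step_le (hℓ : 2 ≤ ℓ) (hC : IsBlockPartition C) (hlam : 0 < lam)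
    (hτ : 0 ≤ τ) (hL : 0 ≤ L) (hU : U ∈ 𝓝ˢ (stiefel (Fin n) (Fin p)))
    (hf : WeaklyConvexOn τ U f) (hlip : FrobLipschitzOn L U f)
    (hX : X ∈ stiefel (Fin n) (Fin p)) (hG : G ∈ clarkeSubdiff f X) {γ : ℝ} (hγ : 0 ≤ γ)
    {X' : BlockPair ℓ → Matrix (Fin n) (Fin p) ℝ}
    (hX' : ∀ e, IsStep γ (pairCols C e) X G (X' e)) :
    ∑ e, envelope f C lam (X' e) ≤ (ℓ.choose 2 : ℝ) * (envelope f C lam X -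
      γ * ((1 / 2 - lam * (τ + (2 * ℓ - 1) * L) / ℓ) * surrogateMeasure f C lam X ^ 2) +
      γ ^ 2 * (stepConst p ℓ L / (2 * lam))) := by
  obtain ⟨b, hb⟩ := hC.exists_index
  have hl : (2 : ℝ) ≤ ℓ := by exact_mod_cast hℓ
  have hXX : Xᵀ * X = 1 := hX
  have hcont := continuousOn_stiefel hU hlip
  have hUX := mem_nhdsSet_iff_forall.1 hU X hX
  obtain ⟨hP, hPmin⟩ := adaptiveProx_mem (lam := lam) hℓ hC hcont hX
  have hGL := frobNorm_le_of_mem_clarkeSubdiff hL hlip hUX hG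
  have hsub := frob_sub_le_of_mem_clarkeSubdiff hf hlip hUX
    (mem_nhdsSet_iff_forall.1 hU _ hP) hG
  -- Comparison with `Z = X` turns the subgradient inequality at `P` into a decrease.
  have hself := hPmin X hX
  rw [sq_surrogateMeasure, envelope]
  set P := adaptiveProx f C lam X with hPdef
  rw [adaptiveNorm_sq hℓ hb hXX, adaptiveNorm_sq hℓ hb hXX, proxDist_self hXX, mul_zero,
    add_zero] at hself
  rw [adaptiveNorm_sq hℓ hb hXX]
  set φ := proxDist b P X with hφ
  have hstep : ∀ e, envelope f C lam (X' e) ≤ f P + 1 / (2 * lam) *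
      (φ + γ * proxSlope b X P (stepDir (pairCols C e) X G) + γ ^ 2 * stepConst p ℓ L) := by
    intro e
    obtain ⟨X₁, hX₁, h1, h2, h3⟩ :=
      IsStep.exists_spec (C := pairCols C e) (G := G) (γ := γ) hXX
    rw [h3 _ (hX' e)]
    -- The old proximal point `P` is a competitor in the problem at the new iterate.
    have h4 := (adaptiveProx_mem (lam := lam) hℓ hC hcont hX₁).2 P hP
    rw [adaptiveNorm_sq hℓ hb hX₁ P] at h4
    refine h4.trans ?_
    have h5 := proxDist_step_le (b := b) hℓ hXX hP hX₁ ((frobNorm_stepDir_le hXX).trans hGL) h1 h2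
    have h6 : 0 ≤ 1 / (2 * lam) := by positivity
    linarith [mul_le_mul_of_nonneg_left h5 h6]
  refine (Finset.sum_le_sum fun e _ => hstep e).trans ?_
  have hslope := sum_proxSlope_le (b := b) hℓ hb hXX hP hGL
  have hcard : (Finset.univ : Finset (BlockPair ℓ)).card = ℓ.choose 2 := card_blockPair
  rw [Finset.sum_add_distrib, ← Finset.mul_sum, Finset.sum_add_distrib, Finset.sum_add_distrib,
    ← Finset.mul_sum]
  simp only [Finset.sum_const, hcard, nsmul_eq_mul]
  have hN : ((ℓ.choose 2 : ℕ) : ℝ) = ℓ * (ℓ - 1) / 2 := choose_two_cast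
  have hd : frobNorm (P - X) ^ 2 ≤ 2 / ℓ * φ := by
    have := le_proxDist (b := b) hℓ P X
    rw [div_mul_eq_mul_div, le_div_iff₀ (by linarith)]
    linarith
  have hq : frob G (P - X) + (2 * ℓ - 3) / 2 * L * frobNorm (P - X) ^ 2 ≤
      -(1 / lam * (1 / 2 - lam * (τ + (2 * ℓ - 1) * L) / ℓ) * φ) := by
    -- The estimate gives `2ℓ - 3`; it is relaxed to the `2ℓ - 1` of the admissible range of `λ`.
    have e1 : frob G (P - X) + (2 * ℓ - 3) / 2 * L * frobNorm (P - X) ^ 2 ≤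
        -(1 / (2 * lam) * φ) + (τ + (2 * ℓ - 1) * L) / 2 * frobNorm (P - X) ^ 2 := by
      nlinarith [mul_nonneg hL (sq_nonneg (frobNorm (P - X)))]
    have e2 : (τ + (2 * ℓ - 1) * L) / 2 * frobNorm (P - X) ^ 2 ≤
        (τ + (2 * ℓ - 1) * L) / 2 * (2 / ℓ * φ) :=
      mul_le_mul_of_nonneg_left hd
        (div_nonneg (add_nonneg hτ (mul_nonneg (by linarith) hL)) (by norm_num))
    refine e1.trans ((add_le_add_right e2 _).trans (le_of_eq ?_))
    field_simp
    ring
  have hl1 : 0 ≤ (ℓ : ℝ) * (ℓ - 1) := mul_nonneg (by linarith) (by linarith)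
  have hfin := hslope.trans (mul_le_mul_of_nonneg_left hq hl1)
  have hfin2 := mul_le_mul_of_nonneg_left hfin (by positivity : 0 ≤ 1 / (2 * lam) * γ)
  rw [hN]
  have e3 : 1 / (2 * lam) * γ * (ℓ * (ℓ - 1) *
      -(1 / lam * (1 / 2 - lam * (τ + (2 * ℓ - 1) * L) / ℓ) * φ)) = -(ℓ * (ℓ - 1) / 2 *
      (γ * ((1 / 2 - lam * (τ + (2 * ℓ - 1) * L) / ℓ) * (φ / lam ^ 2)))) := by
    field_simp
  rw [e3] at hfin2
  have e4 : 1 / (2 * lam) * (γ ^ 2 * stepConst p ℓ L) = γ ^ 2 * (stepConst p ℓ L / (2 * lam)) := by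
    ring
  nlinarith

end Envelope

/-! ### Series with logarithms, and the liminf criterion. -/

section Series

theorem not_summable_inv_mul_log :
    ¬ Summable fun k : ℕ => 1 / (((k : ℝ) + 2) * Real.log ((k : ℝ) + 2)) := by
  set g : ℕ → ℝ := fun k => 1 / (((k : ℝ) + 1) * Real.log ((k : ℝ) + 1)) with hg
  have hshift : (fun k : ℕ => 1 / (((k : ℝ) + 2) * Real.log ((k : ℝ) + 2))) =
      fun k => g (k + 1) := by
    funext k
    simp only [hg, Nat.cast_add, Nat.cast_one, add_assoc, one_add_one_eq_two]
  -- Cauchy condensation compares with the harmonic series. At index 0 the shifted term is `1 / 0 =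
  -- 0`, which is harmless since monotonicity is required only from index 1.
  rw [hshift, summable_nat_add_iff 1, ← summable_condensed_iff_of_nonneg]
  · intro h
    have h1 : Summable fun k : ℕ => 1 / ((k : ℝ) + 1) := by
      refine Summable.of_nonneg_of_le (fun k => by positivity) (fun k => ?_)
        (h.mul_left (2 * Real.log 2))
      have hk : (0 : ℝ) < 2 ^ k := by positivity
      have hk1 : (1 : ℝ) ≤ 2 ^ k := one_le_pow₀ (by norm_num)
      have hle : (2 : ℝ) ^ k + 1 ≤ 2 ^ (k + 1) := by rw [pow_succ]; linarith
      have hlog : Real.log ((2 : ℝ) ^ k + 1) ≤ ((k : ℝ) + 1) * Real.log 2 := by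
        have := Real.log_le_log (by positivity) hle
        rwa [Real.log_pow, Nat.cast_add, Nat.cast_one] at this
      have hpos : 0 < Real.log ((2 : ℝ) ^ k + 1) := Real.log_pos (by linarith)
      have hl2 : 0 < Real.log 2 := Real.log_pos (by norm_num)
      simp only [hg, Nat.cast_pow, Nat.cast_ofNat]
      have e : 2 * Real.log 2 * (2 ^ k * (1 / ((2 ^ k + 1) * Real.log (2 ^ k + 1)))) =
          2 * Real.log 2 * 2 ^ k / ((2 ^ k + 1) * Real.log (2 ^ k + 1)) := by ring
      rw [e, div_le_div_iff₀ (by positivity) (by positivity), one_mul]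
      calc ((2 : ℝ) ^ k + 1) * Real.log (2 ^ k + 1)
          ≤ 2 ^ (k + 1) * (((k : ℝ) + 1) * Real.log 2) :=
            mul_le_mul hle hlog hpos.le (by positivity)
        _ = _ := by ring
    have h2 := (summable_nat_add_iff (f := fun k : ℕ => 1 / (k : ℝ)) 1).1
      (by simpa only [Nat.cast_add, Nat.cast_one] using h1)
    exact Real.not_summable_one_div_natCast h2
  · intro k
    have : 0 ≤ Real.log ((k : ℝ) + 1) := Real.log_nonneg (by linarith [k.cast_nonneg (α := ℝ)])
    positivity
  · intro a c ha hac
    have ha' : (1 : ℝ) ≤ a := by exact_mod_cast ha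
    have hac' : (a : ℝ) ≤ c := by exact_mod_cast hac
    have hpos : 0 < Real.log ((a : ℝ) + 1) := Real.log_pos (by linarith)
    refine one_div_le_one_div_of_le (by positivity) ?_
    exact mul_le_mul (by linarith) (Real.log_le_log (by linarith) (by linarith)) hpos.le
      (by linarith)

theorem summable_inv_mul_log_sq :
    Summable fun k : ℕ => 1 / (((k : ℝ) + 2) * Real.log ((k : ℝ) + 2) ^ 2) := by
  set g : ℕ → ℝ := fun k => 1 / (((k : ℝ) + 1) * Real.log ((k : ℝ) + 1) ^ 2) with hg
  have hshift : (fun k : ℕ => 1 / (((k : ℝ) + 2) * Real.log ((k : ℝ) + 2) ^ 2)) =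
      fun k => g (k + 1) := by
    funext k
    simp only [hg, Nat.cast_add, Nat.cast_one, add_assoc, one_add_one_eq_two]
  rw [hshift, summable_nat_add_iff 1, ← summable_condensed_iff_of_nonneg]
  · have hl2 : 0 < Real.log 2 := Real.log_pos (by norm_num)
    -- The bound `log (2^k + 1) ≥ k log 2` is void at `k = 0`, so that term is dropped.
    rw [← summable_nat_add_iff 1]
    have h1 : Summable fun k : ℕ => 1 / (Real.log 2) ^ 2 * (1 / ((k + 1 : ℕ) : ℝ) ^ 2) :=
      ((summable_nat_add_iff 1).2 (Real.summable_one_div_nat_pow.2 one_lt_two)).mul_left _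
    refine Summable.of_nonneg_of_le (fun k => by positivity) (fun k => ?_) h1
    have hlog : ((k + 1 : ℕ) : ℝ) * Real.log 2 ≤ Real.log ((2 : ℝ) ^ (k + 1) + 1) := by
      rw [← Real.log_pow]
      exact Real.log_le_log (by positivity) (by linarith)
    have hk0 : (0 : ℝ) < (k + 1 : ℕ) := by positivity
    have hpos : 0 < ((k + 1 : ℕ) : ℝ) * Real.log 2 := mul_pos hk0 hl2
    have hp : (0 : ℝ) < 2 ^ (k + 1) := by positivity
    have h2 := pow_le_pow_left₀ hpos.le hlog 2
    simp only [hg, Nat.cast_pow, Nat.cast_ofNat]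
    have hpos' := hpos.trans_le hlog
    rw [mul_one_div, one_div_mul_one_div, div_le_div_iff₀ (by positivity) (by positivity), one_mul,
      ← mul_pow, mul_comm (Real.log 2)]
    exact mul_le_mul (by linarith) h2 (by positivity) (by positivity)
  · intro k
    positivity
  · intro a c ha hac
    have ha' : (1 : ℝ) ≤ a := by exact_mod_cast ha
    have hac' : (a : ℝ) ≤ c := by exact_mod_cast hac
    have hpos : 0 < Real.log ((a : ℝ) + 1) := Real.log_pos (by linarith)
    refine one_div_le_one_div_of_le (by positivity) ?_
    exact mul_le_mul (by linarith)
      (pow_le_pow_left₀ hpos.le (Real.log_le_log (by linarith) (by linarith)) 2) (by positivity)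
      (by linarith)

/-- An eventual bound `√(k+2) Θ_k² ≥ ε²` would make `γ_k Θ_k²` at least `δ ε² / ((k+2) log (k+2))`.
-/
theorem liminf_eq_zero_of_summable {Θ γ : ℕ → ℝ} {δ : ℝ} (hδ : 0 < δ) (hΘ : ∀ k, 0 ≤ Θ k)
    (hγ : ∀ k : ℕ, δ / (Real.sqrt ((k : ℝ) + 2) * Real.log ((k : ℝ) + 2)) ≤ γ k)
    (hsum : Summable fun k => γ k * Θ k ^ 2) :
    liminf (fun k : ℕ => ((((k : ℝ) + 2) ^ (1 / 4 : ℝ) * Θ k : ℝ) : EReal)) atTop = 0 := by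
  refine le_antisymm ?_ ?_
  · by_contra! h
    obtain ⟨ε, hε, hε'⟩ := EReal.lt_iff_exists_real_btwn.1 h
    have hε0 : 0 < ε := by exact_mod_cast hε
    have hev := eventually_lt_of_lt_liminf hε'
    refine not_summable_inv_mul_log ?_
    refine Summable.of_norm_bounded_eventually_nat (hsum.mul_left (1 / (δ * ε ^ 2))) ?_
    filter_upwards [hev] with k hk
    have hk' : ε < ((k : ℝ) + 2) ^ (1 / 4 : ℝ) * Θ k := by exact_mod_cast hk
    have hk0 : (0 : ℝ) ≤ k := k.cast_nonneg
    have hlog : 0 < Real.log ((k : ℝ) + 2) := Real.log_pos (by linarith)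
    have hs : 0 < Real.sqrt ((k : ℝ) + 2) := Real.sqrt_pos.2 (by linarith)
    have hr : (((k : ℝ) + 2) ^ (1 / 4 : ℝ)) ^ 2 = Real.sqrt ((k : ℝ) + 2) := by
      rw [← Real.rpow_natCast, ← Real.rpow_mul (by linarith), Real.sqrt_eq_rpow]
      norm_num
    have h1 : ε ^ 2 ≤ Real.sqrt ((k : ℝ) + 2) * Θ k ^ 2 := by
      rw [← hr, ← mul_pow]
      exact pow_le_pow_left₀ hε0.le hk'.le 2
    have h2 : 1 / (((k : ℝ) + 2) * Real.log ((k : ℝ) + 2)) =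
        1 / (δ * ε ^ 2) * (δ / (Real.sqrt ((k : ℝ) + 2) * Real.log ((k : ℝ) + 2)) *
          (ε ^ 2 / Real.sqrt ((k : ℝ) + 2))) := by
      have : (k : ℝ) + 2 = Real.sqrt ((k : ℝ) + 2) * Real.sqrt ((k : ℝ) + 2) :=
        (Real.mul_self_sqrt (by linarith)).symm
      conv_lhs => rw [show ((k : ℝ) + 2) * Real.log ((k : ℝ) + 2) = Real.sqrt ((k : ℝ) + 2) *
        Real.sqrt ((k : ℝ) + 2) * Real.log ((k : ℝ) + 2) by rw [← this]]
      field_simp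
    rw [Real.norm_of_nonneg (by positivity), h2]
    refine mul_le_mul_of_nonneg_left ?_ (by positivity)
    refine mul_le_mul (hγ k) ?_ (by positivity)
      ((by positivity : 0 ≤ δ / (Real.sqrt ((k : ℝ) + 2) * Real.log ((k : ℝ) + 2))).trans (hγ k))
    rw [div_le_iff₀ hs]
    linarith
  · refine le_liminf_of_le (by isBoundedDefault) (Eventually.of_forall fun k => ?_)
    exact_mod_cast mul_nonneg (by positivity) (hΘ k)

end Series

/-! ### Expectations of functions of finitely many draws. -/

section PairLaw

variable {ℓ : ℕ}

theorem nonempty_blockPair (hℓ : 2 ≤ ℓ) : Nonempty (BlockPair ℓ) := by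
  rw [← Fintype.card_pos_iff, card_blockPair]
  exact Nat.choose_pos hℓ

theorem isProbabilityMeasure_uniform [Nonempty (BlockPair ℓ)] :
    IsProbabilityMeasure (uniformOn (Set.univ : Set (BlockPair ℓ))) :=
  isProbabilityMeasure_uniformOn Set.finite_univ Set.univ_nonempty

instance [Nonempty (BlockPair ℓ)] : IsProbabilityMeasure (pairLaw ℓ) := by
  have := isProbabilityMeasure_uniform (ℓ := ℓ)
  unfold pairLaw
  infer_instance

variable {k : ℕ}

/-- Factoring through a finite space makes measurability and integrability automatic, however
irregular the choice of subgradients or proximal points. Later coordinates are filled with an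
arbitrary pair. -/
theorem exists_eq_comp_restrict {F : (ℕ → BlockPair ℓ) → ℝ}
    (hF : DependsOn F (Set.Iio k)) :
    ∃ g : (Finset.range k → BlockPair ℓ) → ℝ, ∀ ω, F ω = g fun i => ω i := by
  classical
  by_cases hne : Nonempty (BlockPair ℓ)
  · obtain ⟨e⟩ := hne
    refine ⟨fun x => F fun i => if h : i ∈ Finset.range k then x ⟨i, h⟩ else e, fun ω => ?_⟩
    refine hF fun i hi => ?_
    have : i ∈ Finset.range k := Finset.mem_range.2 hi
    simp only [dif_pos this]
  · exact ⟨fun _ => 0, fun ω => (hne ⟨ω 0⟩).elim⟩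

theorem measurable_restrict_range :
    Measurable fun (ω : ℕ → BlockPair ℓ) (i : Finset.range k) => ω i :=
  measurable_pi_lambda _ fun _ => measurable_pi_apply _

theorem measurable_of_dependsOn {F : (ℕ → BlockPair ℓ) → ℝ} (hF : DependsOn F (Set.Iio k)) :
    Measurable F := by
  obtain ⟨g, hg⟩ := exists_eq_comp_restrict hF
  have : F = g ∘ fun ω i => ω i := funext hg
  rw [this]
  exact (Measurable.of_discrete).comp measurable_restrict_range

variable [Nonempty (BlockPair ℓ)]

theorem integrable_of_dependsOn {F : (ℕ → BlockPair ℓ) → ℝ} (hF : DependsOn F (Set.Iio k)) :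
    Integrable F (pairLaw ℓ) := by
  obtain ⟨g, hg⟩ := exists_eq_comp_restrict hF
  obtain ⟨B, hB⟩ := (Set.finite_range fun x => |g x|).bddAbove
  refine Integrable.of_bound (measurable_of_dependsOn hF).aestronglyMeasurable B
    (Eventually.of_forall fun ω => ?_)
  rw [Real.norm_eq_abs, hg]
  exact hB (Set.mem_range_self _)

theorem integral_pairLaw_indicator (e : BlockPair ℓ) :
    ∫ ω, (if ω k = e then (1 : ℝ) else 0) ∂(pairLaw ℓ) = ((ℓ.choose 2 : ℕ) : ℝ)⁻¹ := by
  have := isProbabilityMeasure_uniform (ℓ := ℓ)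
  have h1 : ∫ ω, (if ω k = e then (1 : ℝ) else 0) ∂(pairLaw ℓ) =
      ∫ x, (if x = e then (1 : ℝ) else 0) ∂(uniformOn (Set.univ : Set (BlockPair ℓ))) := by
    have hmp := measurePreserving_eval_infinitePi
      (fun _ : ℕ => uniformOn (Set.univ : Set (BlockPair ℓ))) k
    rw [← hmp.map_eq, integral_map (measurable_pi_apply k).aemeasurable
      (Measurable.of_discrete).aestronglyMeasurable]
    rfl
  have h2 : (fun x : BlockPair ℓ => if x = e then (1 : ℝ) else 0) =
      Set.indicator {e} (fun _ => 1) := by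
    funext x; simp [Set.indicator_apply]
  rw [h1, h2, integral_indicator_const _ (measurableSet_singleton e), smul_eq_mul, mul_one,
    Measure.real, uniformOn_univ, Measure.count_singleton, card_blockPair]
  simp

/-- This plays the role of conditioning on the past: split by the value of draw `k`, which is
independent of the earlier draws, and resample that coordinate. -/
theorem integral_eq_average {F : (ℕ → BlockPair ℓ) → ℝ} (hF : DependsOn F (Set.Iio (k + 1))) :
    ∫ ω, F ω ∂(pairLaw ℓ) = ∫ ω, ((ℓ.choose 2 : ℕ) : ℝ)⁻¹ *
      ∑ e : BlockPair ℓ, F (Function.update ω k e) ∂(pairLaw ℓ) := by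
  have := isProbabilityMeasure_uniform (ℓ := ℓ)
  have hupd : ∀ e, DependsOn (fun ω => F (Function.update ω k e)) (Set.Iio k) := by
    intro e ω ω' h
    refine hF fun i hi => ?_
    by_cases hik : i = k
    · subst hik; simp
    · rw [Function.update_of_ne hik, Function.update_of_ne hik]
      exact h i (lt_of_le_of_ne (Nat.lt_succ_iff.1 hi) hik)
  have hdec : ∀ ω, F ω = ∑ e : BlockPair ℓ,
      (if ω k = e then (1 : ℝ) else 0) * F (Function.update ω k e) := by
    intro ω
    simp
  have hind : iIndepFun (fun (i : ℕ) (ω : ℕ → BlockPair ℓ) => ω i) (pairLaw ℓ) :=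
    iIndepFun_infinitePi (P := fun _ : ℕ => uniformOn (Set.univ : Set (BlockPair ℓ)))
      (X := fun _ x => x) fun _ => measurable_id
  have hsplit := hind.indepFun_finset {k} (Finset.range k) (by simp) fun i => measurable_pi_apply i
  have hterm : ∀ e, ∫ ω, (if ω k = e then (1 : ℝ) else 0) * F (Function.update ω k e) ∂(pairLaw ℓ)
      = ((ℓ.choose 2 : ℕ) : ℝ)⁻¹ * ∫ ω, F (Function.update ω k e) ∂(pairLaw ℓ) := by
    intro e
    obtain ⟨g, hg⟩ := exists_eq_comp_restrict (hupd e)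
    have hcomp := hsplit.comp
      (φ := fun x : ({k} : Finset ℕ) → BlockPair ℓ =>
        if x ⟨k, Finset.mem_singleton_self k⟩ = e then (1 : ℝ) else 0)
      (ψ := g) Measurable.of_discrete Measurable.of_discrete
    have hmeas : Measurable fun ω : ℕ → BlockPair ℓ => if ω k = e then (1 : ℝ) else 0 :=
      (Measurable.of_discrete (f := fun x : BlockPair ℓ => if x = e then (1 : ℝ) else 0)).comp
        (measurable_pi_apply k)
    have hprod := hcomp.integral_fun_mul_eq_mul_integral hmeas.aestronglyMeasurable
      ((Measurable.of_discrete (f := g)).comp measurable_restrict_range).aestronglyMeasurable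
    simp only [hg]
    rw [← integral_pairLaw_indicator (k := k) e]
    exact hprod
  have hint : ∀ e, Integrable (fun ω => F (Function.update ω k e)) (pairLaw ℓ) :=
    fun e => integrable_of_dependsOn (hupd e)
  have hint2 : ∀ e : BlockPair ℓ, Integrable (fun ω : ℕ → BlockPair ℓ =>
      (if ω k = e then (1 : ℝ) else 0) * F (Function.update ω k e)) (pairLaw ℓ) := by
    intro e
    refine integrable_of_dependsOn (k := k + 1) fun ω ω' h => ?_
    have h1 : ω k = ω' k := h k (Nat.lt_succ_self k)
    have h2 := hupd e (fun i (hi : i < k) => h i (hi.trans (Nat.lt_succ_self k)))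
    simp only at h2
    simp only [h1]
    rw [h2]
  rw [integral_const_mul, integral_finsetSum _ fun e _ => hint e, Finset.mul_sum]
  simp_rw [← hterm]
  rw [← integral_finsetSum _ fun e _ => hint2 e]
  exact integral_congr_ae (Eventually.of_forall hdec)

theorem ae_summable_of_summable_integral {θ : ℕ → (ℕ → BlockPair ℓ) → ℝ}
    (h0 : ∀ k ω, 0 ≤ θ k ω) (hθ : ∀ k, DependsOn (θ k) (Set.Iio k))
    (hsum : Summable fun k => ∫ ω, θ k ω ∂(pairLaw ℓ)) :
    ∀ᵐ ω ∂(pairLaw ℓ), Summable fun k => θ k ω := by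
  have hm : ∀ k, Measurable fun ω => ENNReal.ofReal (θ k ω) :=
    fun k => (measurable_of_dependsOn (hθ k)).ennreal_ofReal
  have h1 : ∫⁻ ω, ∑' k, ENNReal.ofReal (θ k ω) ∂(pairLaw ℓ) ≠ ⊤ := by
    rw [lintegral_tsum fun k => (hm k).aemeasurable]
    have : ∀ k, ∫⁻ ω, ENNReal.ofReal (θ k ω) ∂(pairLaw ℓ) =
        ENNReal.ofReal (∫ ω, θ k ω ∂(pairLaw ℓ)) := fun k =>
      (ofReal_integral_eq_lintegral_ofReal (integrable_of_dependsOn (hθ k))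
        (Eventually.of_forall (h0 k))).symm
    simp only [this]
    exact hsum.tsum_ofReal_ne_top
  filter_upwards [ae_lt_top' (AEMeasurable.tsum fun k => (hm k).aemeasurable) h1] with ω hω
  refine (ENNReal.summable_toReal hω.ne).congr fun k => ?_
  rw [ENNReal.toReal_ofReal (h0 k ω)]

end PairLaw

/-! ### Expected descent and summability along a run. -/

section Run

variable {n p ℓ : ℕ} {C : Fin ℓ → Finset (Fin p)} {f : Matrix (Fin n) (Fin p) ℝ → ℝ}
  {γ : ℕ → ℝ} {X₀ : Matrix (Fin n) (Fin p) ℝ}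
  {G X : ℕ → (ℕ → BlockPair ℓ) → Matrix (Fin n) (Fin p) ℝ}

theorem IsRun.mem_stiefel (hrun : IsRun f C γ X₀ G X) (hX₀ : X₀ ∈ stiefel (Fin n) (Fin p)) (k : ℕ)
    (ω : ℕ → BlockPair ℓ) : X k ω ∈ stiefel (Fin n) (Fin p) := by
  induction k with
  | zero => rw [hrun.init]; exact hX₀
  | succ k ih =>
    obtain ⟨X₁, hX₁, -, -, h⟩ := IsStep.exists_spec (C := pairCols C (ω k)) (G := G k ω)
      (γ := γ k) (X := X k ω) ih
    rw [h _ (hrun.step k ω)]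
    exact hX₁

/-- The step is specified by set-valued projections, but its result is unique on the Stiefel
manifold, so each iterate is a function of the earlier draws. -/
theorem IsRun.dependsOn (hrun : IsRun f C γ X₀ G X) (hX₀ : X₀ ∈ stiefel (Fin n) (Fin p)) (k : ℕ) :
    DependsOn (X k) (Set.Iio k) := by
  induction k with
  | zero => intro ω ω' _; rw [hrun.init, hrun.init]
  | succ k ih =>
    intro ω ω' h
    have hlt : ∀ i ∈ Set.Iio k, ω i = ω' i := fun i hi => h i (Nat.lt_succ_of_lt hi)
    obtain ⟨X₁, -, -, -, huniq⟩ := IsStep.exists_spec (C := pairCols C (ω k)) (G := G k ω)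
      (γ := γ k) (hrun.mem_stiefel hX₀ k ω)
    have h' := hrun.step k ω'
    rw [← h k (Nat.lt_succ_self k), ← ih hlt, ← hrun.nonanticipating k hlt] at h'
    rw [huniq _ (hrun.step k ω), huniq _ h']

/-- Resampling draw `k` leaves `X k` and `G k` unchanged, so the alternatives over `e` are all steps
from one point with one subgradient, as `sum_envelope_step_le` requires. -/
theorem IsRun.step_update (hrun : IsRun f C γ X₀ G X) (hX₀ : X₀ ∈ stiefel (Fin n) (Fin p)) (k : ℕ)
    (ω : ℕ → BlockPair ℓ) (e : BlockPair ℓ) :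
    IsStep (γ k) (pairCols C e) (X k ω) (G k ω) (X (k + 1) (Function.update ω k e)) := by
  have hlt : ∀ i ∈ Set.Iio k, Function.update ω k e i = ω i := fun i hi =>
    Function.update_of_ne (ne_of_lt hi) _ _
  have h := hrun.step k (Function.update ω k e)
  rwa [Function.update_self, hrun.dependsOn hX₀ k hlt, hrun.nonanticipating k hlt] at h

variable {U : Set (Matrix (Fin n) (Fin p) ℝ)} {τ L lam : ℝ}

theorem IsRun.integral_envelope_le (hrun : IsRun f C γ X₀ G X)
    (hX₀ : X₀ ∈ stiefel (Fin n) (Fin p)) (hℓ : 2 ≤ ℓ) (hC : IsBlockPartition C) (hlam : 0 < lam)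
    (hτ : 0 ≤ τ) (hL : 0 ≤ L) (hU : U ∈ 𝓝ˢ (stiefel (Fin n) (Fin p)))
    (hf : WeaklyConvexOn τ U f) (hlip : FrobLipschitzOn L U f) (hγ : ∀ k, 0 ≤ γ k) (k : ℕ) :
    ∫ ω, envelope f C lam (X (k + 1) ω) ∂(pairLaw ℓ) ≤ ∫ ω, envelope f C lam (X k ω) ∂(pairLaw ℓ) -
      (1 / 2 - lam * (τ + (2 * ℓ - 1) * L) / ℓ) *
        ∫ ω, γ k * surrogateMeasure f C lam (X k ω) ^ 2 ∂(pairLaw ℓ) +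
      γ k ^ 2 * (stepConst p ℓ L / (2 * lam)) := by
  have hne := nonempty_blockPair hℓ
  have hcomp : ∀ (F : Matrix (Fin n) (Fin p) ℝ → ℝ) k, DependsOn (fun ω => F (X k ω)) (Set.Iio k) :=
    fun F k ω ω' h => congrArg F (hrun.dependsOn hX₀ k h)
  have hN : 0 < ((ℓ.choose 2 : ℕ) : ℝ) := by exact_mod_cast Nat.choose_pos hℓ
  have hi1 := integrable_of_dependsOn (hcomp (envelope f C lam) k)
  have hi2 := integrable_of_dependsOn (hcomp (fun Y => γ k * surrogateMeasure f C lam Y ^ 2) k)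
  have hi3 : Integrable (fun ω => ((ℓ.choose 2 : ℕ) : ℝ)⁻¹ * ∑ e : BlockPair ℓ,
      envelope f C lam (X (k + 1) (Function.update ω k e))) (pairLaw ℓ) := by
    refine integrable_of_dependsOn (k := k + 1) fun ω ω' h => ?_
    refine congrArg _ (Finset.sum_congr rfl fun e _ => hcomp (envelope f C lam) (k + 1) ?_)
    intro i hi
    by_cases hik : i = k
    · subst hik; simp
    · rw [Function.update_of_ne hik, Function.update_of_ne hik, h i hi]
  rw [integral_eq_average (hcomp (envelope f C lam) (k + 1)), ← integral_const_mul,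
    ← integral_sub hi1 (hi2.const_mul _)]
  have hconst : γ k ^ 2 * (stepConst p ℓ L / (2 * lam)) =
      ∫ _, γ k ^ 2 * (stepConst p ℓ L / (2 * lam)) ∂(pairLaw ℓ) := by simp
  have hi4 : Integrable (fun ω => envelope f C lam (X k ω) -
      (1 / 2 - lam * (τ + (2 * ℓ - 1) * L) / ℓ) *
        (γ k * surrogateMeasure f C lam (X k ω) ^ 2)) (pairLaw ℓ) := hi1.sub (hi2.const_mul _)
  rw [hconst, ← integral_add hi4 (integrable_const _)]
  refine integral_mono hi3 (hi4.add (integrable_const _)) fun ω => ?_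
  have h := sum_envelope_step_le hℓ hC hlam hτ hL hU hf hlip (hrun.mem_stiefel hX₀ k ω)
    (hrun.subgrad k ω) (hγ k) (hrun.step_update hX₀ k ω)
  simp only
  rw [inv_mul_le_iff₀ hN]
  refine h.trans (le_of_eq ?_)
  ring

theorem IsRun.summable_integral (hrun : IsRun f C γ X₀ G X)
    (hX₀ : X₀ ∈ stiefel (Fin n) (Fin p)) (hℓ : 2 ≤ ℓ) (hC : IsBlockPartition C)
    (hlam : lam ∈ Set.Ioo 0 ((ℓ : ℝ) / (2 * (τ + (2 * (ℓ : ℝ) - 1) * L))))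
    (hτ : 0 ≤ τ) (hL : 0 < L) (hU : U ∈ 𝓝ˢ (stiefel (Fin n) (Fin p)))
    (hf : WeaklyConvexOn τ U f) (hlip : FrobLipschitzOn L U f) (hγ : ∀ k, 0 ≤ γ k)
    (hγ2 : Summable fun k => γ k ^ 2) :
    Summable fun k => ∫ ω, γ k * surrogateMeasure f C lam (X k ω) ^ 2 ∂(pairLaw ℓ) := by
  have hne := nonempty_blockPair hℓ
  have hl : (2 : ℝ) ≤ ℓ := by exact_mod_cast hℓ
  obtain ⟨hlam0, hlam1⟩ := hlam
  set c := 1 / 2 - lam * (τ + (2 * ℓ - 1) * L) / ℓ with hc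
  set K := stepConst p ℓ L / (2 * lam) with hK
  set I : ℕ → ℝ := fun k => ∫ ω, γ k * surrogateMeasure f C lam (X k ω) ^ 2 ∂(pairLaw ℓ) with hI
  set V : ℕ → ℝ := fun k => ∫ ω, envelope f C lam (X k ω) ∂(pairLaw ℓ) with hV
  have hden : 0 < τ + (2 * (ℓ : ℝ) - 1) * L :=
    add_pos_of_nonneg_of_pos hτ (mul_pos (by linarith) hL)
  -- Positivity of the descent factor is the upper bound on `λ`.
  have hc0 : 0 < c := by
    rw [lt_div_iff₀ (by linarith)] at hlam1
    rw [hc, sub_pos, div_lt_div_iff₀ (by linarith) two_pos]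
    linarith
  have hK0 : 0 ≤ K := by
    have h1 : 0 ≤ ((ℓ : ℝ) - 1) * Real.sqrt p := mul_nonneg (by linarith) (Real.sqrt_nonneg _)
    rw [hK, stepConst]
    exact div_nonneg (mul_nonneg (by positivity) (by linarith)) (by linarith)
  have hstep : ∀ k, V (k + 1) ≤ V k - c * I k + γ k ^ 2 * K := fun k =>
    hrun.integral_envelope_le hX₀ hℓ hC hlam0 hτ hL.le hU hf hlip hγ k
  obtain ⟨m, hm⟩ := exists_le_envelope (lam := lam) hℓ hC hlam0 (continuousOn_stiefel hU hlip)
  have hVm : ∀ k, m ≤ V k := fun k => by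
    have hd : DependsOn (fun ω => envelope f C lam (X k ω)) (Set.Iio k) :=
      fun ω ω' h => congrArg _ (hrun.dependsOn hX₀ k h)
    have h := integral_mono (integrable_const m) (integrable_of_dependsOn hd)
      fun ω => hm _ (hrun.mem_stiefel hX₀ k ω)
    simpa using h
  have htel : ∀ N, c * ∑ k ∈ Finset.range N, I k ≤ V 0 - V N +
      K * ∑ k ∈ Finset.range N, γ k ^ 2 := by
    intro N
    induction N with
    | zero => simp
    | succ N ih =>
      rw [Finset.sum_range_succ, Finset.sum_range_succ, mul_add, mul_add]
      linarith [hstep N]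
  refine summable_of_sum_range_le (c := (V 0 - m + K * ∑' k, γ k ^ 2) / c) (fun k => ?_)
    fun N => ?_
  · exact integral_nonneg fun ω => mul_nonneg (hγ k) (sq_nonneg _)
  · rw [le_div_iff₀ hc0, mul_comm]
    have h1 := hγ2.sum_le_tsum (Finset.range N) fun k _ => sq_nonneg _
    linarith [htel N, hVm N, mul_le_mul_of_nonneg_left h1 hK0]

end Run

end RSSM

end

theorem theorem4p12 {n p ℓ : ℕ} (hp : 1 ≤ p) (hpn : p ≤ n) (hℓ : 2 ≤ ℓ)
    (f : Matrix (Fin n) (Fin p) ℝ → ℝ) (τ L : ℝ) (hτ : 0 ≤ τ) (hL : 0 < L)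
    (U : Set (Matrix (Fin n) (Fin p) ℝ)) (hU_convex : Convex ℝ U)
    (hU_bdd : ∃ R : ℝ, ∀ X ∈ U, RSSM.frobNorm X ≤ R)
    (hU_nhds : U ∈ 𝓝ˢ (RSSM.stiefel (Fin n) (Fin p)))
    (hf : RSSM.WeaklyConvexOn τ U f) (hf_lip : RSSM.FrobLipschitzOn L U f)
    (C : Fin ℓ → Finset (Fin p)) (hC : RSSM.IsBlockPartition C)
    (Δmin : ℝ) (hΔmin : 0 < Δmin) (Δ : ℕ → ℝ)
    (hΔ : ∀ k, Δ k ∈ Set.Ioo Δmin (Real.sqrt 2 * Real.log 2 / L))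
    (γ : ℕ → ℝ)
    (hγ : ∀ k : ℕ, γ k = Δ k / (Real.sqrt ((k : ℝ) + 2) * Real.log ((k : ℝ) + 2)))
    (X₀ : Matrix (Fin n) (Fin p) ℝ) (hX₀ : X₀ ∈ RSSM.stiefel (Fin n) (Fin p))
    (G X : ℕ → (ℕ → RSSM.BlockPair ℓ) → Matrix (Fin n) (Fin p) ℝ)
    (hrun : RSSM.IsRun f C γ X₀ G X)
    (lam : ℝ) (hlam : lam ∈ Set.Ioo 0 ((ℓ : ℝ) / (2 * (τ + (2 * (ℓ : ℝ) - 1) * L)))) :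
    ∀ᵐ ω ∂(RSSM.pairLaw ℓ),
      liminf (fun k : ℕ => ((((k : ℝ) + 2) ^ (1 / 4 : ℝ) *
        RSSM.surrogateMeasure f C lam (X k ω) : ℝ) : EReal)) atTop = 0 := by
  have hne := RSSM.nonempty_blockPair hℓ
  have hk0 : ∀ k : ℕ, (0 : ℝ) ≤ k := fun k => k.cast_nonneg
  have hlog : ∀ k : ℕ, 0 < Real.log ((k : ℝ) + 2) := fun k => Real.log_pos (by linarith [hk0 k])
  have hsqrt : ∀ k : ℕ, 0 < Real.sqrt ((k : ℝ) + 2) := fun k =>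
    Real.sqrt_pos.2 (by linarith [hk0 k])
  have hΔ0 : ∀ k, 0 < Δ k := fun k => hΔmin.trans (hΔ k).1
  have hγ0 : ∀ k, 0 ≤ γ k := fun k => by
    rw [hγ]
    exact div_nonneg (hΔ0 k).le (mul_pos (hsqrt k) (hlog k)).le
  -- The upper bound on `Δ k` serves here, through `∑ 1 / (k log² k) < ∞`; the lower bound `Δmin`
  -- serves in the divergence argument at the end.
  have hγ2 : Summable fun k => γ k ^ 2 := by
    refine Summable.of_nonneg_of_le (fun k => sq_nonneg _) (fun k => ?_)
      (RSSM.summable_inv_mul_log_sq.mul_left ((Real.sqrt 2 * Real.log 2 / L) ^ 2))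
    rw [hγ, div_pow, mul_pow, Real.sq_sqrt (by linarith [hk0 k]), ← mul_one_div]
    have h1 := pow_le_pow_left₀ (hΔ0 k).le (hΔ k).2.le 2
    have h2 := hlog k
    exact mul_le_mul_of_nonneg_right h1 (by positivity)
  have hsum := hrun.summable_integral hX₀ hℓ hC hlam hτ hL hU_nhds hf hf_lip hγ0 hγ2
  have hae := RSSM.ae_summable_of_summable_integral
    (fun k ω => mul_nonneg (hγ0 k) (sq_nonneg (RSSM.surrogateMeasure f C lam (X k ω))))
    (fun k ω ω' h => by simp only [hrun.dependsOn hX₀ k h]) hsum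
  filter_upwards [hae] with ω hω
  refine RSSM.liminf_eq_zero_of_summable hΔmin (fun k => ?_) (fun k => ?_) hω
  · exact mul_nonneg (one_div_nonneg.2 hlam.1.le) (Real.sqrt_nonneg _)
  · rw [hγ]
    exact div_le_div_of_nonneg_right (hΔ k).1.le (mul_pos (hsqrt k) (hlog k)).le
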